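/- Let $d$ be a natural number and $a<b$ real. Let $P,Q,W\in L^\infty([a,b],\mathbb{R}^{d\times d})$ be symmetric matrix-valued functions such that $W(t)\ge\mu_2 I_d$ for a.e. $t$, for some $\mu_2>0$, and such that either $P(t)\ge\mu_1 I_d$ for a.e. $t$, for some $\mu_1>0$, or (without any positivity assumption on $P$) $P(t)$ is invertible for a.e. $t$ and $P^{-1}\in L^1([a,b],\mathbb{R}^{d\times d})$. Let $A,B$ be complex $2d\times 2d$ matrices with $\operatorname{rank}(A\,|\,B)=2d$ and $AB^*=BA^*$. Consider the space $L^2_W([a,b],\mathbb{C}^d)$ of (classes of) measurable $y$ with $\int_a^b y^*Wy\,dt<\infty$, and in it the Sturm–Liouville operator $Ty=W^{-1}(-(Py')'+Qy)$ whose domain consists of all $y\in L^2_W$ such that $y$ and $Py'$ are absolutely continuous on $[a,b]$, $Ty\in L^2_W$, and $$A\begin{pmatrix}-y(a)\\ y(b)\end{pmatrix}+B\begin{pmatrix}(Py')(a)\\ (Py')(b)\end{pmatrix}=0 .$$ For $\lambda\in\mathbb{C}$ let $\phi_{1,\lambda},\dots,\phi_{2d,\lambda}$ be the solutions of $-(Py')'+Qy=\lambda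 Wy$ on $[a,b]$ for which the $2d\times 2d$ matrix with columns $\begin{pmatrix}\phi_{j,\lambda}(a)\\ (P\phi_{j,\lambda}')(a)\end{pmatrix}$ is the identity. Let $\Phi_\lambda$ and $\Psi_\lambda$ be the $2d\times 2d$ matrices with columns $\begin{pmatrix}-\phi_{j,\lambda}(a)\\ \phi_{j,\lambda}(b)\end{pmatrix}$ and $\begin{pmatrix}(P\phi_{j,\lambda}')(a)\\ (P\phi_{j,\lambda}')(b)\end{pmatrix}$, and put $\Gamma(\lambda)=\det(A\Phi_\lambda+B\Psi_\lambda)$. Let $\lambda_*\in\mathbb{C}$ be an eigenvalue of $T$. Then the following three multiplicities of $\lambda_*$ are finite and equal: the analytic multiplicity, i.e. the order of $\lambda_*$ as a zero of $\Gamma$; the geometric multiplicity, i.e. $\dim\{y\in D(T): Ty=\lambda_* y\}$; and the algebraic multiplicity, i.e. $\dim\{y\in L^2_W: (T-\lambda_*)^k y=0\text{ for some integer }k\ge 1\}$. -/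

import Mathlib

open MeasureTheory Matrix

/-- The complex version of a real matrix. -/
noncomputable def cplx {d : ℕ} (M : Matrix (Fin d) (Fin d) ℝ) : Matrix (Fin d) (Fin d) ℂ :=
  M.map Complex.ofReal

/-- Lebesgue measure on the interval `[a, b]`. -/
noncomputable def lebIcc (a b : ℝ) : Measure ℝ := volume.restrict (Set.Icc a b)

/-- A `d`-dimensional Sturm-Liouville equation `-(P y')' + Q y = λ W y` on `[a, b]`. The
coefficients are real symmetric and essentially bounded, `W` is uniformly positive, and `P` is
either uniformly positive or, with no condition on signs, invertible almost everywhere with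
integrable inverse. -/
structure SLEquation (d : ℕ) (a b : ℝ) where
  P : ℝ → Matrix (Fin d) (Fin d) ℝ
  Q : ℝ → Matrix (Fin d) (Fin d) ℝ
  W : ℝ → Matrix (Fin d) (Fin d) ℝ
  lt : a < b
  P_symm : ∀ᵐ t ∂lebIcc a b, (P t).IsSymm
  Q_symm : ∀ᵐ t ∂lebIcc a b, (Q t).IsSymm
  W_symm : ∀ᵐ t ∂lebIcc a b, (W t).IsSymm
  P_bdd : ∀ i j, MemLp (fun t => P t i j) ⊤ (lebIcc a b)
  Q_bdd : ∀ i j, MemLp (fun t => Q t i j) ⊤ (lebIcc a b)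
  W_bdd : ∀ i j, MemLp (fun t => W t i j) ⊤ (lebIcc a b)
  W_pos : ∃ μ₂ : ℝ, 0 < μ₂ ∧
    ∀ᵐ t ∂lebIcc a b, (W t - μ₂ • (1 : Matrix (Fin d) (Fin d) ℝ)).PosSemidef
  P_pos_or_invertible :
    (∃ μ₁ : ℝ, 0 < μ₁ ∧
      ∀ᵐ t ∂lebIcc a b, (P t - μ₁ • (1 : Matrix (Fin d) (Fin d) ℝ)).PosSemidef) ∨
    ((∀ᵐ t ∂lebIcc a b, IsUnit (P t)) ∧
      ∀ i j, Integrable (fun t => (P t)⁻¹ i j) (lebIcc a b))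

/-- A self-adjoint boundary condition `(A | B) Y(a,b) = 0`: complex `2d × 2d` matrices with
`rank (A | B) = 2d` and `A B* = B A*`. -/
structure SLBoundary (d : ℕ) where
  A : Matrix (Fin d ⊕ Fin d) (Fin d ⊕ Fin d) ℂ
  B : Matrix (Fin d ⊕ Fin d) (Fin d ⊕ Fin d) ℂ
  rank_eq : (Matrix.fromCols A B).rank = 2 * d
  selfAdjoint : A * Bᴴ = B * Aᴴ

namespace SLEquation

variable {d : ℕ} {a b : ℝ}

theorem form_eq {M : Matrix (Fin d) (Fin d) ℝ} (h : M.PosSemidef) :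
    ∃ N : Matrix (Fin d) (Fin d) ℂ, ∀ v w : Fin d → ℂ,
      star v ⬝ᵥ (cplx M *ᵥ w) = star (N *ᵥ v) ⬝ᵥ (N *ᵥ w) := by
  obtain ⟨N, rfl⟩ : ∃ N : Matrix (Fin d) (Fin d) ℝ, M = Nᴴ * N := by
    open scoped MatrixOrder in
    obtain ⟨N, hN⟩ := CStarAlgebra.nonneg_iff_eq_star_mul_self.mp h.nonneg
    exact ⟨N, hN⟩
  refine ⟨cplx N, fun v w => ?_⟩
  have : cplx (Nᴴ * N) = (cplx N)ᴴ * cplx N := by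
    ext i j
    simp [cplx, Matrix.mul_apply]
  rw [this, Matrix.star_mulVec, ← Matrix.mulVec_mulVec, Matrix.dotProduct_mulVec,
    Matrix.dotProduct_mulVec]

theorem norm_star_dot (v : Fin d → ℂ) : ‖star v ⬝ᵥ v‖ = ∑ i, ‖v i‖ ^ 2 := by
  have : star v ⬝ᵥ v = ((∑ i, ‖v i‖ ^ 2 : ℝ) : ℂ) := by
    simp [dotProduct, Complex.conj_mul']
  rw [this, Complex.norm_real, Real.norm_of_nonneg (by positivity)]

theorem form_add_le {M : Matrix (Fin d) (Fin d) ℝ} (h : M.PosSemidef) (v w : Fin d → ℂ) :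
    ‖star (v + w) ⬝ᵥ (cplx M *ᵥ (v + w))‖ ≤
      2 * ‖star v ⬝ᵥ (cplx M *ᵥ v)‖ + 2 * ‖star w ⬝ᵥ (cplx M *ᵥ w)‖ := by
  obtain ⟨N, hN⟩ := form_eq h
  rw [hN, hN, hN, norm_star_dot, norm_star_dot, norm_star_dot, Finset.mul_sum, Finset.mul_sum,
    ← Finset.sum_add_distrib]
  refine Finset.sum_le_sum fun i _ => ?_
  rw [Matrix.mulVec_add, Pi.add_apply]
  have h1 := norm_add_le ((N *ᵥ v) i) ((N *ᵥ w) i)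
  nlinarith [sq_nonneg (‖(N *ᵥ v) i‖ - ‖(N *ᵥ w) i‖), norm_nonneg ((N *ᵥ v) i + (N *ᵥ w) i)]

theorem W_posSemidef (E : SLEquation d a b) : ∀ᵐ t ∂lebIcc a b, (E.W t).PosSemidef := by
  obtain ⟨μ₂, h0, h⟩ := E.W_pos
  filter_upwards [h] with t ht
  have := ht.add ((Matrix.PosSemidef.one (n := Fin d) (R := ℝ)).smul h0.le)
  simpa using this

theorem form_aestronglyMeasurable (E : SLEquation d a b) (y : ℝ → Fin d → ℂ)
    (hy : AEStronglyMeasurable y (lebIcc a b)) :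
    AEStronglyMeasurable (fun t => star (y t) ⬝ᵥ (cplx (E.W t) *ᵥ y t)) (lebIcc a b) := by
  have hyi : ∀ i, AEStronglyMeasurable (fun t => y t i) (lebIcc a b) := fun i =>
    (continuous_apply i).comp_aestronglyMeasurable hy
  have hW : ∀ i j, AEStronglyMeasurable (fun t => ((E.W t i j : ℝ) : ℂ)) (lebIcc a b) :=
    fun i j => Complex.continuous_ofReal.comp_aestronglyMeasurable (E.W_bdd i j).1
  have : (fun t => star (y t) ⬝ᵥ (cplx (E.W t) *ᵥ y t)) =
      fun t => ∑ i, star (y t i) * ∑ j, ((E.W t i j : ℝ) : ℂ) * y t j := by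
    ext t
    simp [dotProduct, Matrix.mulVec, cplx]
  rw [this]
  exact Finset.aestronglyMeasurable_fun_sum _ fun i _ => (hyi i).star.mul
    (Finset.aestronglyMeasurable_fun_sum _ fun j _ => (hW i j).mul (hyi j))

/-- The weighted space `L²_W([a, b], ℂᵈ)` of classes of measurable functions `y` with
`∫ y* W y < ∞`. -/
noncomputable def L2W (E : SLEquation d a b) : Submodule ℂ (ℝ →ₘ[lebIcc a b] (Fin d → ℂ)) where
  carrier := {y | Integrable (fun t => star (y t) ⬝ᵥ (cplx (E.W t) *ᵥ y t)) (lebIcc a b)}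
  zero_mem' := by
    refine (integrable_zero ℝ ℂ (lebIcc a b)).congr ?_
    filter_upwards [AEEqFun.coeFn_zero (μ := lebIcc a b) (α := ℝ) (β := Fin d → ℂ)] with t ht
    simp [ht]
  add_mem' := by
    intro y z hy hz
    refine ((hy.norm.const_mul 2).add (hz.norm.const_mul 2)).mono'
      (E.form_aestronglyMeasurable _ (y + z).aestronglyMeasurable) ?_
    filter_upwards [AEEqFun.coeFn_add y z, E.W_posSemidef] with t ht hW
    rw [ht]
    exact form_add_le hW (y t) (z t)
  smul_mem' := by
    intro c y hy
    refine (Integrable.const_mul hy (star c * c)).congr ?_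
    filter_upwards [AEEqFun.coeFn_smul c y] with t ht
    rw [ht]
    simp [Matrix.mulVec_smul, mul_assoc, mul_left_comm]

/-- `y` is absolutely continuous on `[a, b]` and `z` is the absolutely continuous version of the
quasi-derivative `P y'`. -/
structure IsQuasiPair (E : SLEquation d a b) (y z : ℝ → Fin d → ℂ) : Prop where
  ac : AbsolutelyContinuousOnInterval y a b
  ac_quasi : AbsolutelyContinuousOnInterval z a b
  eq : ∀ᵐ t ∂lebIcc a b, z t = cplx (E.P t) *ᵥ deriv y t

theorem ae_differentiableAt {y : ℝ → Fin d → ℂ} (h : AbsolutelyContinuousOnInterval y a b) :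
    ∀ᵐ t ∂lebIcc a b, DifferentiableAt ℝ y t := by
  rw [lebIcc, ae_restrict_iff' measurableSet_Icc]
  filter_upwards [h.boundedVariationOn.ae_differentiableAt_of_mem_uIcc] with t ht hm
  exact ht (Set.Icc_subset_uIcc hm)

theorem ae_mem_Ioo (a b : ℝ) : ∀ᵐ t ∂lebIcc a b, t ∈ Set.Ioo a b := by
  rw [lebIcc, ← restrict_Ioo_eq_restrict_Icc]
  exact ae_restrict_mem measurableSet_Ioo

theorem deriv_eq_zero_of_eqOn {y : ℝ → Fin d → ℂ}
    (h : Set.EqOn y (fun _ => 0) (Set.Icc a b)) {t : ℝ} (ht : t ∈ Set.Ioo a b) :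
    deriv y t = 0 := by
  have : y =ᶠ[nhds t] fun _ => 0 :=
    Filter.eventuallyEq_of_mem (Icc_mem_nhds ht.1 ht.2) h
  rw [this.deriv_eq]
  simp

theorem IsQuasiPair.zero (E : SLEquation d a b) : E.IsQuasiPair 0 0 where
  ac := by
    have := (LipschitzWith.const (α := ℝ) (0 : Fin d → ℂ)).lipschitzOnWith (s := Set.uIcc a b)
    exact this.absolutelyContinuousOnInterval
  ac_quasi := by
    have := (LipschitzWith.const (α := ℝ) (0 : Fin d → ℂ)).lipschitzOnWith (s := Set.uIcc a b)
    exact this.absolutelyContinuousOnInterval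
  eq := Filter.Eventually.of_forall fun t => by
    have : deriv (0 : ℝ → Fin d → ℂ) t = 0 := by
      change deriv (fun _ => 0) t = 0
      simp
    simp [this]

theorem IsQuasiPair.add {E : SLEquation d a b} {y z y' z' : ℝ → Fin d → ℂ}
    (h : E.IsQuasiPair y z) (h' : E.IsQuasiPair y' z') : E.IsQuasiPair (y + y') (z + z') where
  ac := h.ac.add h'.ac
  ac_quasi := h.ac_quasi.add h'.ac_quasi
  eq := by
    filter_upwards [h.eq, h'.eq, ae_differentiableAt h.ac, ae_differentiableAt h'.ac]
      with t k1 k2 d1 d2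
    rw [deriv_add d1 d2, Matrix.mulVec_add, Pi.add_apply, k1, k2]

theorem IsQuasiPair.smul {E : SLEquation d a b} {y z : ℝ → Fin d → ℂ}
    (h : E.IsQuasiPair y z) (c : ℂ) : E.IsQuasiPair (c • y) (c • z) where
  ac := h.ac.const_smul c
  ac_quasi := h.ac_quasi.const_smul c
  eq := by
    filter_upwards [h.eq, ae_differentiableAt h.ac] with t k1 d1
    rw [deriv_const_smul c d1, Matrix.mulVec_smul, Pi.smul_apply, k1]

/-- The expression `-(P y')' + Q y`, where `z = P y'`. -/
noncomputable def expr (E : SLEquation d a b) (y z : ℝ → Fin d → ℂ) (t : ℝ) : Fin d → ℂ :=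
  -deriv z t + cplx (E.Q t) *ᵥ y t

/-- `y`, with quasi-derivative `z = P y'`, solves `-(P y')' + Q y = λ W y` on `[a, b]`. -/
def IsSolution (E : SLEquation d a b) (lam : ℂ) (y z : ℝ → Fin d → ℂ) : Prop :=
  E.IsQuasiPair y z ∧ ∀ᵐ t ∂lebIcc a b, E.expr y z t = lam • (cplx (E.W t) *ᵥ y t)

end SLEquation

/-- The boundary condition `A (-y(a); y(b)) + B (z(a); z(b)) = 0`, where `z = P y'`. -/
def SLBoundary.Holds {d : ℕ} (C : SLBoundary d) (a b : ℝ) (y z : ℝ → Fin d → ℂ) : Prop :=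
  C.A *ᵥ Sum.elim (-y a) (y b) + C.B *ᵥ Sum.elim (z a) (z b) = 0

namespace SLEquation

variable {d : ℕ} {a b : ℝ}

/-- The graph of the Sturm-Liouville operator in `L²_W × L²_W`. A pair `(u, f)` belongs to it when
`u` has an absolutely continuous representative `y` with absolutely continuous `P y'`, satisfying
the boundary condition, and `f = W⁻¹ (-(P y')' + Q y)`. -/
noncomputable def graph (E : SLEquation d a b) (C : SLBoundary d) :
    Submodule ℂ (E.L2W × E.L2W) where
  carrier := {p | ∃ y z : ℝ → Fin d → ℂ, E.IsQuasiPair y z ∧ C.Holds a b y z ∧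
    (p.1 : ℝ →ₘ[lebIcc a b] (Fin d → ℂ)) =ᵐ[lebIcc a b] y ∧
    (p.2 : ℝ →ₘ[lebIcc a b] (Fin d → ℂ)) =ᵐ[lebIcc a b]
      fun t => (cplx (E.W t))⁻¹ *ᵥ E.expr y z t}
  zero_mem' := by
    refine ⟨0, 0, IsQuasiPair.zero E, ?_, AEEqFun.coeFn_zero, ?_⟩
    · funext i
      have : Sum.elim (0 : Fin d → ℂ) (0 : Fin d → ℂ) = 0 := by
        ext i; cases i <;> rfl
      simp [this]
    · refine (AEEqFun.coeFn_zero (μ := lebIcc a b) (α := ℝ) (β := Fin d → ℂ)).trans ?_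
      refine Filter.Eventually.of_forall fun t => ?_
      have : deriv (0 : ℝ → Fin d → ℂ) t = 0 := by
        change deriv (fun _ => 0) t = 0
        simp
      simp [expr, this]
  add_mem' := by
    rintro ⟨u, f⟩ ⟨v, g⟩ ⟨y, z, h1, h2, h3, h4⟩ ⟨y', z', h1', h2', h3', h4'⟩
    refine ⟨y + y', z + z', h1.add h1', ?_, ?_, ?_⟩
    · have e1 : Sum.elim (-(y + y') a) ((y + y') b) =
          Sum.elim (-y a) (y b) + Sum.elim (-y' a) (y' b) := by
        ext i; cases i <;> simp [add_comm]
      have e2 : Sum.elim ((z + z') a) ((z + z') b) =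
          Sum.elim (z a) (z b) + Sum.elim (z' a) (z' b) := by
        ext i; cases i <;> simp
      unfold SLBoundary.Holds at h2 h2' ⊢
      rw [e1, e2, Matrix.mulVec_add, Matrix.mulVec_add, add_add_add_comm, h2, h2', add_zero]
    · filter_upwards [AEEqFun.coeFn_add u.1 v.1, h3, h3'] with t ht k1 k2
      change ((u.1 + v.1 : ℝ →ₘ[lebIcc a b] (Fin d → ℂ)) : ℝ → Fin d → ℂ) t = _
      rw [ht, Pi.add_apply, Pi.add_apply, k1, k2]
    · filter_upwards [AEEqFun.coeFn_add f.1 g.1, h4, h4', ae_differentiableAt h1.ac_quasi,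
        ae_differentiableAt h1'.ac_quasi] with t ht k1 k2 d1 d2
      change ((f.1 + g.1 : ℝ →ₘ[lebIcc a b] (Fin d → ℂ)) : ℝ → Fin d → ℂ) t = _
      rw [ht, Pi.add_apply, k1, k2, ← Matrix.mulVec_add]
      simp only [expr, deriv_add d1 d2, Pi.add_apply]
      rw [Matrix.mulVec_add (cplx (E.Q t))]
      congr 1
      abel
  smul_mem' := by
    rintro c ⟨u, f⟩ ⟨y, z, h1, h2, h3, h4⟩
    refine ⟨c • y, c • z, h1.smul c, ?_, ?_, ?_⟩
    · have e1 : Sum.elim (-(c • y) a) ((c • y) b) = c • Sum.elim (-y a) (y b) := by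
        ext i; cases i <;> simp
      have e2 : Sum.elim ((c • z) a) ((c • z) b) = c • Sum.elim (z a) (z b) := by
        ext i; cases i <;> simp
      unfold SLBoundary.Holds at h2 ⊢
      rw [e1, e2, Matrix.mulVec_smul, Matrix.mulVec_smul, ← smul_add, h2, smul_zero]
    · filter_upwards [AEEqFun.coeFn_smul c u.1, h3] with t ht k1
      change ((c • u.1 : ℝ →ₘ[lebIcc a b] (Fin d → ℂ)) : ℝ → Fin d → ℂ) t = _
      rw [ht, Pi.smul_apply, Pi.smul_apply, k1]
    · filter_upwards [AEEqFun.coeFn_smul c f.1, h4, ae_differentiableAt h1.ac_quasi]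
        with t ht k1 d1
      change ((c • f.1 : ℝ →ₘ[lebIcc a b] (Fin d → ℂ)) : ℝ → Fin d → ℂ) t = _
      rw [ht, Pi.smul_apply, k1, ← Matrix.mulVec_smul]
      simp only [expr, deriv_const_smul c d1, Pi.smul_apply, Matrix.mulVec_smul, smul_add, smul_neg]

theorem graph_functional (E : SLEquation d a b) (C : SLBoundary d) :
    ∀ p : E.L2W × E.L2W, p ∈ E.graph C → p.1 = 0 → p.2 = 0 := by
  rintro ⟨u, f⟩ ⟨y, z, h1, h2, h3, h4⟩ (hu : u = 0)
  subst hu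
  have hy : y =ᵐ[volume.restrict (Set.Icc a b)] fun _ => 0 := h3.symm.trans AEEqFun.coeFn_zero
  have hIcc : Set.uIcc a b = Set.Icc a b := Set.uIcc_of_le E.lt.le
  have hy0 : Set.EqOn y (fun _ => 0) (Set.Icc a b) :=
    Measure.eqOn_Icc_of_ae_eq volume E.lt.ne hy (hIcc ▸ h1.ac.continuousOn) continuousOn_const
  have hz : z =ᵐ[volume.restrict (Set.Icc a b)] fun _ => 0 := by
    filter_upwards [h1.eq, ae_mem_Ioo a b] with t ht hm
    rw [ht, deriv_eq_zero_of_eqOn hy0 hm, Matrix.mulVec_zero]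
  have hz0 : Set.EqOn z (fun _ => 0) (Set.Icc a b) :=
    Measure.eqOn_Icc_of_ae_eq volume E.lt.ne hz (hIcc ▸ h1.ac_quasi.continuousOn)
      continuousOn_const
  refine Subtype.ext (AEEqFun.ext ?_)
  refine Filter.EventuallyEq.trans ?_
    (AEEqFun.coeFn_zero (μ := lebIcc a b) (α := ℝ) (β := Fin d → ℂ)).symm
  filter_upwards [h4, ae_mem_Ioo a b] with t ht hm
  rw [ht, expr, deriv_eq_zero_of_eqOn hz0 hm, hy0 (Set.Ioo_subset_Icc_self hm)]
  simp

/-- The Sturm-Liouville operator `T y = W⁻¹ (-(P y')' + Q y)` in `L²_W`, with its domain. -/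
noncomputable def operator (E : SLEquation d a b) (C : SLBoundary d) : E.L2W →ₗ.[ℂ] E.L2W :=
  (E.graph C).toLinearPMap

/-- The operator has the prescribed graph. -/
theorem operator_graph (E : SLEquation d a b) (C : SLBoundary d) :
    (E.operator C).graph = E.graph C :=
  Submodule.toLinearPMap_graph_eq _ (E.graph_functional C)

end SLEquation

/-- The kernel of `(T - λ)ᵏ` for an unbounded operator `T`, on its natural domain: `u` is in the
kernel of `(T - λ)ᵏ⁺¹` when `u` is in the domain of `T` and `T u - λ u` is in the kernel of
`(T - λ)ᵏ`. -/
noncomputable def LinearPMap.kerPow {H : Type*} [AddCommGroup H] [Module ℂ H] (T : H →ₗ.[ℂ] H)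
    (lam : ℂ) : ℕ → Submodule ℂ H
  | 0 => ⊥
  | k + 1 => ((LinearPMap.kerPow T lam k).comap
      (T.toFun - lam • T.domain.subtype)).map T.domain.subtype

theorem LinearPMap.mem_kerPow_succ {H : Type*} [AddCommGroup H] [Module ℂ H] (T : H →ₗ.[ℂ] H)
    (lam : ℂ) (k : ℕ) (u : H) :
    u ∈ T.kerPow lam (k + 1) ↔
      ∃ h : u ∈ T.domain, T ⟨u, h⟩ - lam • u ∈ T.kerPow lam k := by
  simp [LinearPMap.kerPow, Submodule.mem_map]

theorem LinearPMap.kerPow_mono {H : Type*} [AddCommGroup H] [Module ℂ H] (T : H →ₗ.[ℂ] H)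
    (lam : ℂ) : Monotone (T.kerPow lam) := by
  refine monotone_nat_of_le_succ fun k => ?_
  induction k with
  | zero => exact bot_le
  | succ k ih =>
    intro u hu
    rw [LinearPMap.mem_kerPow_succ] at hu ⊢
    obtain ⟨h, hu⟩ := hu
    exact ⟨h, ih hu⟩

/-- The eigenspace `{u ∈ D(T) : T u = λ u}`. -/
noncomputable def LinearPMap.eigenspace {H : Type*} [AddCommGroup H] [Module ℂ H]
    (T : H →ₗ.[ℂ] H) (lam : ℂ) : Submodule ℂ H where
  carrier := {u | ∃ h : u ∈ T.domain, T ⟨u, h⟩ = lam • u}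
  zero_mem' := by
    exact ⟨zero_mem _, by rw [smul_zero]; exact T.map_zero⟩
  add_mem' := by
    rintro u v ⟨hu, eu⟩ ⟨hv, ev⟩
    exact ⟨add_mem hu hv, by rw [smul_add, ← eu, ← ev]; exact T.map_add ⟨u, hu⟩ ⟨v, hv⟩⟩
  smul_mem' := by
    rintro c u ⟨hu, eu⟩
    exact ⟨Submodule.smul_mem _ c hu, by
      rw [smul_comm, ← eu]; exact T.map_smul c ⟨u, hu⟩⟩

/-- The root space `{u : (T - λ)ᵏ u = 0 for some k ≥ 1}`. -/
noncomputable def LinearPMap.rootSpace {H : Type*} [AddCommGroup H] [Module ℂ H]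
    (T : H →ₗ.[ℂ] H) (lam : ℂ) : Submodule ℂ H where
  carrier := {u | ∃ k : ℕ, 1 ≤ k ∧ u ∈ T.kerPow lam k}
  zero_mem' := ⟨1, le_rfl, zero_mem _⟩
  add_mem' := by
    rintro u v ⟨k, hk, hu⟩ ⟨l, hl, hv⟩
    exact ⟨max k l, le_max_of_le_left hk, add_mem (T.kerPow_mono lam (le_max_left k l) hu)
      (T.kerPow_mono lam (le_max_right k l) hv)⟩
  smul_mem' := by
    rintro c u ⟨k, hk, hu⟩
    exact ⟨k, hk, Submodule.smul_mem _ c hu⟩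

namespace SLEquation

variable {d : ℕ} {a b : ℝ}

/-- `(y, z)` with `z = P y'` is the `j`-th fundamental solution: the solution of the equation whose
initial vector `(y(a); z(a))` is the `j`-th column of the identity matrix `I_{2d}`. -/
def IsFundamental (E : SLEquation d a b) (lam : ℂ) (j : Fin d ⊕ Fin d)
    (p : (ℝ → Fin d → ℂ) × (ℝ → Fin d → ℂ)) : Prop :=
  E.IsSolution lam p.1 p.2 ∧
    ∀ i, Sum.elim (p.1 a) (p.2 a) i = (1 : Matrix (Fin d ⊕ Fin d) (Fin d ⊕ Fin d) ℂ) i j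

/-- The `j`-th fundamental solution together with its quasi-derivative. (It exists and is unique on
`[a, b]` by the theory of linear equations with integrable coefficients.) -/
noncomputable def fundamental (E : SLEquation d a b) (lam : ℂ) (j : Fin d ⊕ Fin d) :
    (ℝ → Fin d → ℂ) × (ℝ → Fin d → ℂ) :=
  Classical.epsilon (E.IsFundamental lam j)

/-- The matrix `Φ_λ`, with columns `(-φ_j(a); φ_j(b))`. -/
noncomputable def Phi (E : SLEquation d a b) (lam : ℂ) :
    Matrix (Fin d ⊕ Fin d) (Fin d ⊕ Fin d) ℂ :=
  Matrix.of fun i j => Sum.elim (-(E.fundamental lam j).1 a) ((E.fundamental lam j).1 b) i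

/-- The matrix `Ψ_λ`, with columns `((P φ_j')(a); (P φ_j')(b))`. -/
noncomputable def Psi (E : SLEquation d a b) (lam : ℂ) :
    Matrix (Fin d ⊕ Fin d) (Fin d ⊕ Fin d) ℂ :=
  Matrix.of fun i j => Sum.elim ((E.fundamental lam j).2 a) ((E.fundamental lam j).2 b) i

/-- The function `Γ(λ) = det (A Φ_λ + B Ψ_λ)`. -/
noncomputable def Gam (E : SLEquation d a b) (C : SLBoundary d) (lam : ℂ) : ℂ :=
  (C.A * E.Phi lam + C.B * E.Psi lam).det

/-- `λ` is an eigenvalue of the Sturm-Liouville operator. -/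
def IsEigenvalue (E : SLEquation d a b) (C : SLBoundary d) (lam : ℂ) : Prop :=
  ∃ u : (E.operator C).domain, (u : E.L2W) ≠ 0 ∧ E.operator C u = lam • (u : E.L2W)

/-- The analytic multiplicity: the order of `λ` as a zero of `Γ`. -/
noncomputable def analyticMultiplicity (E : SLEquation d a b) (C : SLBoundary d) (lam : ℂ) : ℕ∞ :=
  analyticOrderAt (E.Gam C) lam

/-- The geometric multiplicity: the dimension of the eigenspace, in `ℕ ∪ {∞}`. -/
noncomputable def geometricMultiplicity (E : SLEquation d a b) (C : SLBoundary d) (lam : ℂ) : ℕ∞ :=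
  Cardinal.toENat (Module.rank ℂ ((E.operator C).eigenspace lam))

/-- The algebraic multiplicity: the dimension of the root space, in `ℕ ∪ {∞}`. -/
noncomputable def algebraicMultiplicity (E : SLEquation d a b) (C : SLBoundary d) (lam : ℂ) : ℕ∞ :=
  Cardinal.toENat (Module.rank ℂ ((E.operator C).rootSpace lam))

end SLEquation

/-! With `x = (y, z)` and `z = P y'`, the equation is a first order system `x' = (K₀ + λ K₁) x` with
integrable coefficients, that is, `x = c + V₀ x + λ V₁ x` for two Volterra operators. Powers of a
Volterra operator decay factorially, so `1 - V₀ - λ V₁` is always invertible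
(`isUnit_one_sub_volterra`). Hence the solution `x_λ(v)` with initial vector `v` exists, is unique
and is analytic in `λ`.

Let `M(λ) v` be the boundary form of `x_λ(v)`. Then `Γ = det M`, and `v ↦ x_λ(v)` identifies `ker
M(λ)` with the eigenspace (`boundaryMatrix_eq`, `eigenspace_eq_map`), which is therefore
finite-dimensional.

Green's formula and `A B* = B A*` make `T` symmetric (`integral_form_sub_eq_zero`), so the
eigenvalue `λ` is real. If `(T - λ) u = f` and `(T - λ) f = 0`, then `⟨f, f⟩ = ⟨(T - λ) u, f⟩ = ⟨u,
(T - λ) f⟩ = 0` (`eq_zero_of_mem_graph`). This excludes Jordan chains, so the root space is the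
eigenspace.

The same fact gives the order of `Γ`. The derivative of `x_λ(v)` in `λ` solves the equation with
source `W x_λ(v)` (`deriv_pencilSol_eq`). If `M(λ) v = 0` and `M'(λ) v = M(λ) w`, then this
derivative minus `x_λ(w)` satisfies the boundary condition, and `T - λ` maps it to the eigenfunction
of `v`; so `v = 0`. Under this condition the order of `det M` equals `dim ker M(λ)`
(`analyticOrderAt_det_eq_finrank_ker`). -/

/-! ### Absolutely continuous functions with values in a normed space. -/

theorem AbsolutelyContinuousOnInterval.of_dist_le {X Y : Type*} [PseudoMetricSpace X]
    [PseudoMetricSpace Y] {f : ℝ → X} {h : ℝ → Y} {a b : ℝ}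
    (hh : AbsolutelyContinuousOnInterval h a b)
    (H : ∀ s ∈ Set.uIcc a b, ∀ t ∈ Set.uIcc a b, dist (f s) (f t) ≤ dist (h s) (h t)) :
    AbsolutelyContinuousOnInterval f a b := by
  rw [absolutelyContinuousOnInterval_iff] at hh ⊢
  intro ε hε
  obtain ⟨δ, hδ, h'⟩ := hh ε hε
  refine ⟨δ, hδ, fun I hI hlt => lt_of_le_of_lt (Finset.sum_le_sum fun i hi => ?_) (h' I hI hlt)⟩
  exact H _ (hI.1 i hi).1 _ (hI.1 i hi).2

theorem AbsolutelyContinuousOnInterval.congr {X : Type*} [PseudoMetricSpace X] {f g : ℝ → X}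
    {a b : ℝ} (hf : AbsolutelyContinuousOnInterval f a b) (H : Set.EqOn f g (Set.uIcc a b)) :
    AbsolutelyContinuousOnInterval g a b :=
  hf.of_dist_le fun s hs t ht => by rw [H hs, H ht]

theorem AbsolutelyContinuousOnInterval.clm_comp {𝕜 F G : Type*} [NontriviallyNormedField 𝕜]
    [NormedAddCommGroup F] [NormedSpace 𝕜 F] [NormedAddCommGroup G] [NormedSpace 𝕜 G]
    {f : ℝ → F} {a b : ℝ} (hf : AbsolutelyContinuousOnInterval f a b) (L : F →L[𝕜] G) :
    AbsolutelyContinuousOnInterval (fun t => L (f t)) a b := by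
  rw [absolutelyContinuousOnInterval_iff] at hf ⊢
  intro ε hε
  obtain ⟨δ, hδ, h'⟩ := hf (ε / (‖L‖ + 1)) (by positivity)
  refine ⟨δ, hδ, fun I hI hlt => ?_⟩
  have h1 := h' I hI hlt
  rw [lt_div_iff₀ (by positivity)] at h1
  refine lt_of_le_of_lt ?_ h1
  rw [Finset.sum_mul]
  refine Finset.sum_le_sum fun i _ => ?_
  rw [dist_eq_norm, dist_eq_norm, ← map_sub, mul_comm]
  refine (L.le_opNorm _).trans ?_
  gcongr
  linarith

theorem AbsolutelyContinuousOnInterval.prodMk {F G : Type*} [PseudoMetricSpace F]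
    [PseudoMetricSpace G] {f : ℝ → F} {g : ℝ → G} {a b : ℝ}
    (hf : AbsolutelyContinuousOnInterval f a b) (hg : AbsolutelyContinuousOnInterval g a b) :
    AbsolutelyContinuousOnInterval (fun t => (f t, g t)) a b := by
  rw [absolutelyContinuousOnInterval_iff] at hf hg ⊢
  intro ε hε
  obtain ⟨δ, hδ, h1⟩ := hf (ε / 2) (by positivity)
  obtain ⟨δ', hδ', h2⟩ := hg (ε / 2) (by positivity)
  refine ⟨min δ δ', lt_min hδ hδ', fun I hI hlt => ?_⟩
  have k1 := h1 I hI (hlt.trans_le (min_le_left _ _))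
  have k2 := h2 I hI (hlt.trans_le (min_le_right _ _))
  refine lt_of_le_of_lt (b := _ + _) ?_ (by simpa using add_lt_add k1 k2)
  rw [← Finset.sum_add_distrib]
  refine Finset.sum_le_sum fun i _ => ?_
  rw [Prod.dist_eq]
  exact max_le_add_of_nonneg dist_nonneg dist_nonneg

/-- The increments are dominated by those of the real primitive of `‖f‖`. -/
theorem IntervalIntegrable.absolutelyContinuousOnInterval_primitive {F : Type*}
    [NormedAddCommGroup F] [NormedSpace ℝ F] {f : ℝ → F} {a b : ℝ}
    (h : IntervalIntegrable f volume a b) :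
    AbsolutelyContinuousOnInterval (fun x => ∫ v in a..x, f v) a b := by
  refine (h.norm.absolutelyContinuousOnInterval_intervalIntegral
    Set.left_mem_uIcc).of_dist_le fun s hs t ht => ?_
  have sub : ∀ s ∈ Set.uIcc a b, IntervalIntegrable f volume a s := fun s hs =>
    h.mono_set (Set.uIcc_subset_uIcc Set.left_mem_uIcc hs)
  rw [dist_eq_norm, dist_eq_norm,
    intervalIntegral.integral_interval_sub_left (sub s hs) (sub t ht),
    intervalIntegral.integral_interval_sub_left (sub s hs).norm (sub t ht).norm, Real.norm_eq_abs]
  exact intervalIntegral.norm_integral_le_abs_integral_norm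

/-- The fundamental theorem of calculus for absolutely continuous functions with values in a
Banach space. -/
theorem AbsolutelyContinuousOnInterval.eq_add_integral {F : Type*} [NormedAddCommGroup F]
    [NormedSpace ℝ F] [CompleteSpace F] {f g : ℝ → F} {a b : ℝ}
    (hf : AbsolutelyContinuousOnInterval f a b) (hg : IntervalIntegrable g volume a b)
    (hd : ∀ᵐ x, x ∈ Set.uIcc a b → HasDerivAt f (g x) x) {x : ℝ} (hx : x ∈ Set.uIcc a b) :
    f x = f a + ∫ t in a..x, g t := by
  -- The difference of `f` and the primitive of `g` has derivative zero almost everywhere, so it is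
  -- constant.
  have hac := hf.sub hg.absolutelyContinuousOnInterval_primitive
  obtain ⟨C, hC⟩ := hac.const_of_ae_hasDerivAt_zero <| by
    filter_upwards [hd, hg.ae_hasDerivAt_integral] with x h1 h2 hx
    simpa using (h1 hx).sub (h2 hx a Set.left_mem_uIcc)
  have h1 := hC x hx
  have h2 := hC a Set.left_mem_uIcc
  simp only [Pi.sub_apply, intervalIntegral.integral_same, sub_zero] at h1 h2
  rw [h2, ← h1]
  abel

/-- Real and imaginary parts reduce this to real functions. Green's formula uses it to integrate the
derivative of the bracket without a separate bound. -/
theorem AbsolutelyContinuousOnInterval.intervalIntegrable_of_ae_hasDerivAt {f g : ℝ → ℂ} {a b : ℝ}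
    (hf : AbsolutelyContinuousOnInterval f a b)
    (hd : ∀ᵐ x, x ∈ Set.uIcc a b → HasDerivAt f (g x) x) : IntervalIntegrable g volume a b := by
  have key : ∀ L : ℂ →L[ℝ] ℝ, IntervalIntegrable (fun t => L (g t)) volume a b := fun L => by
    refine (hf.clm_comp L).intervalIntegrable_deriv.congr_ae ?_
    rw [Filter.EventuallyEq, ae_restrict_iff' measurableSet_uIoc]
    filter_upwards [hd] with x hx hm
    exact (L.hasFDerivAt.comp_hasDerivAt x (hx (Set.uIoc_subset_uIcc hm))).deriv
  rw [intervalIntegrable_iff]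
  have h1 := intervalIntegrable_iff.1 (key Complex.reCLM)
  have h2 := intervalIntegrable_iff.1 (key Complex.imCLM)
  have := (h1.ofReal (𝕜 := ℂ)).add ((h2.ofReal (𝕜 := ℂ)).mul_const Complex.I)
  refine this.congr (Filter.Eventually.of_forall fun t => ?_)
  exact Complex.re_add_im (g t)

theorem AbsolutelyContinuousOnInterval.pow {f : ℝ → ℝ} {a b : ℝ}
    (hf : AbsolutelyContinuousOnInterval f a b) (n : ℕ) :
    AbsolutelyContinuousOnInterval (fun t => f t ^ n) a b := by
  induction n with
  | zero =>
    have := (LipschitzWith.const (α := ℝ) (1 : ℝ)).lipschitzOnWith (s := Set.uIcc a b)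
    simpa using this.absolutelyContinuousOnInterval
  | succ n ih => simpa [pow_succ] using ih.fun_mul hf

/-- Iterated primitives of an integrable function: `∫ₐˣ k κⁿ / n! = κ(x)ⁿ⁺¹ / (n + 1)!` for the
primitive `κ` of `k`. -/
theorem IntervalIntegrable.integral_mul_primitive_pow {k : ℝ → ℝ} {a b : ℝ}
    (hk : IntervalIntegrable k volume a b) (n : ℕ) {x : ℝ} (hx : x ∈ Set.uIcc a b) :
    ∫ t in a..x, k t * ((∫ s in a..t, k s) ^ n / n.factorial) =
      (∫ s in a..x, k s) ^ (n + 1) / (n + 1).factorial := by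
  have hac := hk.absolutelyContinuousOnInterval_primitive
  have h1 := (((hac.pow (n + 1)).const_smul ((n + 1).factorial : ℝ)⁻¹)).eq_add_integral
    (g := fun t => k t * ((∫ s in a..t, k s) ^ n / n.factorial)) ?_ ?_ hx
  · simp at h1
    rw [← h1]
    field_simp
  · exact hk.mul_continuousOn ((hac.continuousOn.pow n).div_const _)
  · filter_upwards [hk.ae_hasDerivAt_integral] with t ht hm
    have := ((ht hm a Set.left_mem_uIcc).pow (n + 1)).const_mul ((n + 1).factorial : ℝ)⁻¹
    refine this.congr_deriv ?_
    rw [Nat.factorial_succ]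
    push_cast
    field_simp

/-! ### Volterra operators with integrable kernel. -/

section Volterra

variable {F : Type*} [NormedAddCommGroup F] [NormedSpace ℂ F] {a b : ℝ} {K : ℝ → F →L[ℂ] F}

theorem intervalIntegrable_clm_apply (hab : a ≤ b) (hK : IntervalIntegrable K volume a b)
    (f : C(Set.Icc a b, F)) :
    IntervalIntegrable (fun s => K s (f (Set.projIcc a b hab s))) volume a b := by
  have hc : Continuous fun s => f (Set.projIcc a b hab s) :=
    f.continuous.comp continuous_projIcc
  rw [intervalIntegrable_iff] at hK ⊢
  refine (hK.norm.mul_const ‖f‖).mono' ?_ (Filter.Eventually.of_forall fun s => ?_)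
  · exact (ContinuousLinearMap.apply ℂ F).flip.aestronglyMeasurable_comp₂ hK.1
        hc.aestronglyMeasurable
  · exact ((K s).le_opNorm _).trans (by gcongr; exact f.norm_coe_le_norm _)

theorem IntervalIntegrable.mono_Icc {E : Type*} [NormedAddCommGroup E] {f : ℝ → E}
    (h : IntervalIntegrable f volume a b) (t : Set.Icc a b) :
    IntervalIntegrable f volume a t :=
  h.mono_set (Set.uIcc_subset_uIcc Set.left_mem_uIcc (Set.Icc_subset_uIcc t.2))

variable [NormedSpace ℝ F] [SMulCommClass ℝ ℂ F]

/-- The Volterra operator `(V f)(t) = ∫ₐᵗ K(s) f(s) ds` on the continuous functions on `[a, b]`. -/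
noncomputable def volterra (hab : a ≤ b) (hK : IntervalIntegrable K volume a b) :
    C(Set.Icc a b, F) →L[ℂ] C(Set.Icc a b, F) :=
  LinearMap.mkContinuous
    { toFun := fun f =>
        { toFun := fun t => ∫ s in a..t, K s (f (Set.projIcc a b hab s))
          continuous_toFun :=
            (Set.uIcc_of_le hab ▸ (intervalIntegrable_clm_apply hab hK
              f).absolutelyContinuousOnInterval_primitive.continuousOn).domRestrict }
      map_add' := fun f g => by
        ext t
        have hf := (intervalIntegrable_clm_apply hab hK f).mono_Icc t
        have hg := (intervalIntegrable_clm_apply hab hK g).mono_Icc t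
        change _ = (∫ s in a..t, K s (f (Set.projIcc a b hab s))) +
          ∫ s in a..t, K s (g (Set.projIcc a b hab s))
        simp [intervalIntegral.integral_add hf hg]
      map_smul' := fun c f => by
        ext t
        change _ = c • ∫ s in a..t, K s (f (Set.projIcc a b hab s))
        simp }
    (∫ s in a..b, ‖K s‖) <| by
  intro f
  rw [ContinuousMap.norm_le _ (by
    have := intervalIntegral.integral_nonneg (μ := volume) hab fun s _ => norm_nonneg (K s)
    positivity)]
  intro t
  have h1 : ‖∫ s in a..t, K s (f (Set.projIcc a b hab s))‖ ≤ ∫ s in a..t, ‖K s‖ * ‖f‖ := by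
    refine intervalIntegral.norm_integral_le_of_norm_le t.2.1
      (Filter.Eventually.of_forall fun s _ => ?_) ((hK.mono_Icc t).norm.mul_const _)
    exact ((K s).le_opNorm _).trans (by gcongr; exact f.norm_coe_le_norm _)
  refine h1.trans ?_
  rw [intervalIntegral.integral_mul_const]
  gcongr
  exact intervalIntegral.integral_mono_interval le_rfl t.2.1 t.2.2
    (Filter.Eventually.of_forall fun s => norm_nonneg _) hK.norm

variable (hab : a ≤ b) (hK : IntervalIntegrable K volume a b)

@[simp]
theorem volterra_apply (f : C(Set.Icc a b, F)) (t : Set.Icc a b) :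
    volterra hab hK f t = ∫ s in a..t, K s (f (Set.projIcc a b hab s)) := rfl

/-- The bound is kept pointwise in `t`, since the induction integrates it against `‖K‖`;
`integral_mul_primitive_pow` then produces the next factorial. -/
theorem norm_volterra_pow_apply_le (n : ℕ) (f : C(Set.Icc a b, F)) (t : Set.Icc a b) :
    ‖(volterra hab hK ^ n) f t‖ ≤ (∫ s in a..t, ‖K s‖) ^ n / n.factorial * ‖f‖ := by
  induction n generalizing t with
  | zero => simpa using f.norm_coe_le_norm t
  | succ n ih =>
    have hk := hK.norm
    rw [pow_succ', mul_apply_eq_comp, volterra_apply]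
    have hint : IntervalIntegrable
        (fun s => ‖K s‖ * ((∫ r in a..s, ‖K r‖) ^ n / n.factorial)) volume a b :=
      hk.mul_continuousOn
        ((hk.absolutelyContinuousOnInterval_primitive.continuousOn.pow n).div_const _)
    refine (intervalIntegral.norm_integral_le_of_norm_le t.2.1
      (g := fun s => ‖K s‖ * ((∫ r in a..s, ‖K r‖) ^ n / n.factorial) * ‖f‖)
      (Filter.Eventually.of_forall fun s hs => ?_) ((hint.mono_Icc t).mul_const _)).trans ?_
    · have hs' : s ∈ Set.Icc a b := ⟨hs.1.le, hs.2.trans t.2.2⟩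
      have := ih (Set.projIcc a b hab s)
      rw [Set.projIcc_of_mem hab hs'] at this ⊢
      rw [mul_assoc]
      exact ((K s).le_opNorm _).trans (by gcongr)
    · rw [intervalIntegral.integral_mul_const,
        hk.integral_mul_primitive_pow n (Set.Icc_subset_uIcc t.2)]

/-- Some power `Vⁿ` has norm below one, so `1 - Vⁿ` is a unit by the Neumann series; `1 - V` is one
of its two commuting factors. No smallness of `K` is needed. -/
theorem isUnit_one_sub_volterra [CompleteSpace F] : IsUnit (1 - volterra hab hK) := by
  obtain ⟨n, hn⟩ : ∃ n : ℕ, (∫ s in a..b, ‖K s‖) ^ n / n.factorial < 1 :=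
    ((FloorSemiring.tendsto_pow_div_factorial_atTop
      (∫ s in a..b, ‖K s‖)).eventually_lt_const one_pos).exists
  have h0 : 0 ≤ ∫ s in a..b, ‖K s‖ :=
    intervalIntegral.integral_nonneg hab fun s _ => norm_nonneg (K s)
  have hlt : ‖volterra hab hK ^ n‖ < 1 := by
    refine (ContinuousLinearMap.opNorm_le_bound _ (by positivity) fun f => ?_).trans_lt hn
    rw [ContinuousMap.norm_le _ (by positivity)]
    intro t
    refine (norm_volterra_pow_apply_le hab hK n f t).trans ?_
    gcongr
    · exact intervalIntegral.integral_nonneg t.2.1 fun s _ => norm_nonneg (K s)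
    · exact intervalIntegral.integral_mono_interval le_rfl t.2.1 t.2.2
        (Filter.Eventually.of_forall fun s => norm_nonneg _) hK.norm
  have hu : IsUnit (1 - volterra hab hK ^ n) :=
    isUnit_one_sub_of_norm_lt_one (R := C(Set.Icc a b, F) →L[ℂ] C(Set.Icc a b, F)) hlt
  rw [← mul_neg_geom_sum] at hu
  refine (Commute.isUnit_mul_iff ?_).1 hu |>.1
  exact (Commute.one_left _).sub_left
    (Commute.sum_right _ _ _ fun i _ => (Commute.refl _).pow_right i)

end Volterra

/-! ### Analytic dependence on the spectral parameter. -/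

section LinearPencil

variable {X : Type*} [NormedAddCommGroup X] [NormedSpace ℂ X] {S T : X →L[ℂ] X} {l : ℂ}

/-- The solution `x` of `x = c + S x + l T x`. -/
noncomputable def pencilSol (S T : X →L[ℂ] X) (l : ℂ) : X →L[ℂ] X :=
  Ring.inverse (1 - (S + l • T))

theorem pencilSol_eq (h : IsUnit (1 - (S + l • T))) (c : X) :
    pencilSol S T l c = c + (S (pencilSol S T l c) + l • T (pencilSol S T l c)) :=
  sub_eq_iff_eq_add.1 (DFunLike.congr_fun (Ring.mul_inverse_cancel _ h) c)

theorem eq_pencilSol (h : IsUnit (1 - (S + l • T))) {c x : X} (hx : x = c + (S x + l • T x)) :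
    x = pencilSol S T l c := by
  have h1 : (1 - (S + l • T)) x = c := sub_eq_iff_eq_add.2 hx
  rw [← h1]
  exact (DFunLike.congr_fun (Ring.inverse_mul_cancel _ h) x).symm

/-- Inversion in a Banach algebra is analytic at units, and the pencil is affine in `z`. -/
theorem analyticAt_pencilSol [CompleteSpace X] (h : IsUnit (1 - (S + l • T))) (c : X) :
    AnalyticAt ℂ (fun z => pencilSol S T z c) l := by
  obtain ⟨u, hu⟩ := h
  have h1 : AnalyticAt ℂ (fun z : ℂ => 1 - (S + z • T)) l :=
    analyticAt_const.sub (analyticAt_const.add (analyticAt_id.smul analyticAt_const))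
  have h2 := analyticAt_inverse (𝕜 := ℂ) u
  rw [hu] at h2
  have h3 : AnalyticAt ℂ (fun z : ℂ => Ring.inverse (1 - (S + z • T))) l :=
    AnalyticAt.comp (g := Ring.inverse) (f := fun z : ℂ => 1 - (S + z • T)) h2 h1
  exact ((ContinuousLinearMap.apply ℂ X c).analyticAt _).comp h3

/-- Differentiate the fixed point equation in `z`: the constant `c` disappears and the product rule
leaves the source `T x`. -/
theorem deriv_pencilSol_eq [CompleteSpace X] (h : ∀ z : ℂ, IsUnit (1 - (S + z • T))) (c : X) :
    deriv (fun z => pencilSol S T z c) l = S (deriv (fun z => pencilSol S T z c) l) +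
      l • T (deriv (fun z => pencilSol S T z c) l) + T (pencilSol S T l c) := by
  have h0 := (analyticAt_pencilSol (h l) c).differentiableAt.hasDerivAt
  have h1 : HasDerivAt (fun z => c + (S (pencilSol S T z c) + z • T (pencilSol S T z c)))
      (S (deriv (fun z => pencilSol S T z c) l) +
        (l • T (deriv (fun z => pencilSol S T z c) l) + (1 : ℂ) • T (pencilSol S T l c))) l :=
    ((S.hasFDerivAt.comp_hasDerivAt l h0).add
      ((hasDerivAt_id l).fun_smul (T.hasFDerivAt.comp_hasDerivAt l h0))).const_add c
  rw [one_smul, ← add_assoc] at h1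
  exact h0.unique (h1.congr_of_eventuallyEq
    (Filter.Eventually.of_forall fun z => pencilSol_eq (h z) c))

end LinearPencil

/-! ### The order of vanishing of a determinant. -/

/-- The order at `z₀` of the determinant of an analytic matrix function `M` is the dimension of the
kernel of `M z₀`, provided that the derivative of `M` maps no nonzero vector of this kernel into the
range of `M z₀`. -/
theorem analyticOrderAt_det_eq_finrank_ker {n : Type*} [Fintype n] [DecidableEq n]
    {M : ℂ → Matrix n n ℂ} {z₀ : ℂ} (hM : ∀ i j, AnalyticAt ℂ (fun z => M z i j) z₀)
    (H : ∀ v w, M z₀ *ᵥ v = 0 → deriv (fun z => M z *ᵥ v) z₀ = M z₀ *ᵥ w → v = 0) :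
    analyticOrderAt (fun z => (M z).det) z₀ =
      Module.finrank ℂ (LinearMap.ker (M z₀).mulVecLin) := by
  classical
  set S := LinearMap.ker (M z₀).mulVecLin with hS
  obtain ⟨S', hS'⟩ := S.exists_isCompl
  -- A basis adapted to the kernel `S` and a complement `S'`: the columns `M z *ᵥ B s` with `s` in
  -- the first block vanish at `z₀`.
  set B := (Module.finBasis ℂ S).prod (Module.finBasis ℂ S') |>.map
    (Submodule.prodEquivOfIsCompl S S' hS') with hB
  have hcard : Fintype.card (Fin (Module.finrank ℂ S) ⊕ Fin (Module.finrank ℂ S')) =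
      Fintype.card n := by
    rw [← Module.finrank_eq_card_basis B, Module.finrank_fintype_fun_eq_card]
  let e := Fintype.equivOfCardEq hcard
  have hBl : ∀ i, B (Sum.inl i) = (Module.finBasis ℂ S i : n → ℂ) := fun i => by simp [hB]
  have hBr : ∀ i, B (Sum.inr i) = (Module.finBasis ℂ S' i : n → ℂ) := fun i => by simp [hB]
  have hker : ∀ i, M z₀ *ᵥ B (Sum.inl i) = 0 := fun i => by
    rw [hBl]
    exact (Module.finBasis ℂ S i).2
  have hcol : ∀ v : n → ℂ, ∀ i, AnalyticAt ℂ (fun z => (M z *ᵥ v) i) z₀ := fun v i => by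
    simp only [Matrix.mulVec, dotProduct]
    exact Finset.analyticAt_fun_sum _ fun j _ => (hM i j).mul analyticAt_const
  have hdiff : ∀ v : n → ℂ, HasDerivAt (fun z => M z *ᵥ v) (deriv (fun z => M z *ᵥ v) z₀) z₀ :=
    fun v => (differentiableAt_pi.2 fun i => (hcol v i).differentiableAt).hasDerivAt
  -- These are the columns with a factor `z - z₀` removed from each one in the kernel block; at `z₀`
  -- such a column is the derivative of `M z *ᵥ B s`.
  let N : ℂ → Fin (Module.finrank ℂ S) ⊕ Fin (Module.finrank ℂ S') → n → ℂ := fun z =>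
    Sum.elim (fun k i => dslope (fun z => (M z *ᵥ B (Sum.inl k)) i) z₀ z)
      (fun k => M z *ᵥ B (Sum.inr k))
  let c : ℂ → Fin (Module.finrank ℂ S) ⊕ Fin (Module.finrank ℂ S') → ℂ := fun z =>
    Sum.elim (fun _ => z - z₀) (fun _ => 1)
  have hMB : ∀ z s, M z *ᵥ B s = c z s • N z s := by
    intro z s
    cases s with
    | inl k =>
      ext i
      have := sub_smul_dslope (fun z => (M z *ᵥ B (Sum.inl k)) i) z₀ z
      rw [hker k, Pi.zero_apply, sub_zero] at this
      exact this.symm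
    | inr k => simp [c, N]
  have hNan : ∀ i s, AnalyticAt ℂ (fun z => N z s i) z₀ := by
    intro i s
    cases s with
    | inl k =>
      obtain ⟨p, hp⟩ := hcol (B (Sum.inl k)) i
      exact ⟨_, hp.has_fpower_series_dslope_fslope⟩
    | inr k => exact hcol _ i
  have hNli : LinearIndependent ℂ (N z₀) := by
    rw [Fintype.linearIndependent_iff]
    intro g hg
    set v := ∑ k, g (Sum.inl k) • B (Sum.inl k) with hv
    set w := ∑ k, g (Sum.inr k) • B (Sum.inr k) with hw
    have hvker : M z₀ *ᵥ v = 0 := by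
      simp [hv, Matrix.mulVec_sum, Matrix.mulVec_smul, hker]
    have hdv : deriv (fun z => M z *ᵥ v) z₀ = ∑ k, g (Sum.inl k) • N z₀ (Sum.inl k) := by
      have h1 : (fun z => M z *ᵥ v) = fun z => ∑ k, g (Sum.inl k) • (M z *ᵥ B (Sum.inl k)) := by
        ext1 z
        simp [hv, Matrix.mulVec_sum, Matrix.mulVec_smul]
      have h2 : HasDerivAt (fun z => ∑ k, g (Sum.inl k) • (M z *ᵥ B (Sum.inl k)))
          (∑ k, g (Sum.inl k) • deriv (fun z => M z *ᵥ B (Sum.inl k)) z₀) z₀ :=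
        HasDerivAt.fun_sum fun k _ => (hdiff (B (Sum.inl k))).const_smul (g (Sum.inl k))
      rw [h1, h2.deriv]
      refine Finset.sum_congr rfl fun k _ => ?_
      congr 1
      ext i
      simp only [N, Sum.elim_inl, dslope_same]
      exact ((hasDerivAt_pi.1 (hdiff (B (Sum.inl k)))) i).deriv.symm
    have hMw : M z₀ *ᵥ w = ∑ k, g (Sum.inr k) • N z₀ (Sum.inr k) := by
      simp [hw, Matrix.mulVec_sum, Matrix.mulVec_smul, N]
    rw [Fintype.sum_sum_type, ← hdv, ← hMw] at hg
    -- A linear relation among the columns of `N z₀` says `M'(z₀) v + M(z₀) w = 0`, which is the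
    -- situation of `H`.
    have hv0 : v = 0 := H v (-w) hvker
      (by rw [Matrix.mulVec_neg]; exact eq_neg_of_add_eq_zero_left hg)
    have hw0 : w = 0 := by
      have h1 : w ∈ S := by
        rw [hv0] at hg
        simpa [hS, LinearMap.mem_ker] using hg
      have h2 : w ∈ S' := by
        rw [hw]
        exact Submodule.sum_mem _ fun k _ =>
          Submodule.smul_mem _ _ (hBr k ▸ (Module.finBasis ℂ S' k).2)
      exact Submodule.disjoint_def.1 hS'.disjoint w h1 h2
    refine Fintype.linearIndependent_iff.1 B.linearIndependent g ?_
    rw [Fintype.sum_sum_type, ← hv, ← hw, hv0, hw0, add_zero]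
  have hdetne : ∀ f : Fin (Module.finrank ℂ S) ⊕ Fin (Module.finrank ℂ S') → n → ℂ,
      LinearIndependent ℂ f → (Matrix.of fun i j => f (e.symm j) i).det ≠ 0 := by
    intro f hf
    rw [← isUnit_iff_ne_zero, ← Matrix.isUnit_iff_isUnit_det,
      ← Matrix.linearIndependent_cols_iff_isUnit]
    exact hf.comp _ e.symm.injective
  have hprod : ∀ z, ∏ j, c z (e.symm j) = (z - z₀) ^ Module.finrank ℂ S := by
    intro z
    rw [Equiv.prod_comp e.symm (c z), Fintype.prod_sum_type]
    simp [c]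
  -- Each kernel column contributes one factor `z - z₀`; the remaining determinant is nonzero at
  -- `z₀`.
  have hdet : ∀ z, (M z).det * (Matrix.of fun i j => B (e.symm j) i).det =
      (z - z₀) ^ Module.finrank ℂ S * (Matrix.of fun i j => N z (e.symm j) i).det := by
    intro z
    rw [← Matrix.det_mul, ← hprod z, ← Matrix.det_mul_row]
    congr 1
    ext i j
    exact congrFun (hMB z (e.symm j)) i
  have hdetan : ∀ A : ℂ → Matrix n n ℂ, (∀ i j, AnalyticAt ℂ (fun z => A z i j) z₀) →
      AnalyticAt ℂ (fun z => (A z).det) z₀ := by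
    intro A hA
    simp only [Matrix.det_apply']
    exact Finset.analyticAt_fun_sum _ fun σ _ =>
      analyticAt_const.mul (Finset.analyticAt_fun_prod _ fun i _ => hA _ _)
  have hU := hdetne B B.linearIndependent
  rw [(hdetan M hM).analyticOrderAt_eq_natCast]
  refine ⟨fun z => (Matrix.of fun i j => N z (e.symm j) i).det /
      (Matrix.of fun i j => B (e.symm j) i).det,
    (hdetan _ fun i j => hNan i _).div analyticAt_const hU,
    div_ne_zero (hdetne _ hNli) hU, Filter.Eventually.of_forall fun z => ?_⟩
  rw [smul_eq_mul, ← mul_div_assoc, ← hdet z, mul_div_cancel_right₀ _ hU]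

/-! ### The first order system and its solutions. -/

namespace SLEquation

variable {d : ℕ} {a b : ℝ}

theorem ae_isUnit_P (E : SLEquation d a b) : ∀ᵐ t ∂lebIcc a b, IsUnit (E.P t) := by
  obtain ⟨μ₁, h0, h⟩ | ⟨h, -⟩ := E.P_pos_or_invertible
  · filter_upwards [h] with t ht
    have := Matrix.PosDef.posSemidef_add ht ((Matrix.PosDef.one (n := Fin d) (R := ℝ)).smul h0)
    rw [sub_add_cancel] at this
    exact this.isUnit
  · exact h

theorem ae_isUnit_W (E : SLEquation d a b) : ∀ᵐ t ∂lebIcc a b, IsUnit (E.W t) := by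
  obtain ⟨μ₂, h0, h⟩ := E.W_pos
  filter_upwards [h] with t ht
  have := Matrix.PosDef.posSemidef_add ht ((Matrix.PosDef.one (n := Fin d) (R := ℝ)).smul h0)
  rw [sub_add_cancel] at this
  exact this.isUnit

/-- For the `j`-th column `v` of the inverse, `μ |v|² ≤ v · M v = v j`. Hence `v j ≤ μ⁻¹`, and then
`μ (v i)² ≤ v j ≤ μ⁻¹` for every `i`. -/
theorem abs_inv_apply_le {M : Matrix (Fin d) (Fin d) ℝ} {μ : ℝ} (hμ : 0 < μ)
    (h : (M - μ • (1 : Matrix (Fin d) (Fin d) ℝ)).PosSemidef) (i j : Fin d) :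
    |M⁻¹ i j| ≤ μ⁻¹ := by
  have hu : IsUnit M := by
    have := Matrix.PosDef.posSemidef_add h ((Matrix.PosDef.one (n := Fin d) (R := ℝ)).smul hμ)
    rw [sub_add_cancel] at this
    exact this.isUnit
  set v : Fin d → ℝ := M⁻¹ *ᵥ Pi.single j 1 with hv
  have hvi : ∀ i, v i = M⁻¹ i j := fun i => by simp [hv]
  have hMv : M *ᵥ v = Pi.single j 1 := by
    rw [hv, Matrix.mulVec_mulVec, Matrix.mul_nonsing_inv _ ((Matrix.isUnit_iff_isUnit_det M).1 hu),
      Matrix.one_mulVec]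
  have h1 := h.dotProduct_mulVec_nonneg v
  rw [Matrix.sub_mulVec, hMv, Matrix.smul_mulVec, Matrix.one_mulVec, dotProduct_sub,
    dotProduct_smul] at h1
  simp only [star_trivial, dotProduct_single, mul_one, smul_eq_mul] at h1
  rw [dotProduct] at h1
  have h2 : ∀ i, v i * v i ≤ ∑ i, v i * v i := fun i =>
    Finset.single_le_sum (f := fun i => v i * v i) (fun i _ => mul_self_nonneg _)
      (Finset.mem_univ i)
  have h3 : ∀ i, μ * (v i * v i) ≤ v j := fun i => by
    have := mul_le_mul_of_nonneg_left (h2 i) hμ.le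
    linarith
  have h4 : v j ≤ μ⁻¹ := by
    rw [← one_div, le_div_iff₀ hμ]
    by_contra! hc
    have := h3 j
    have hpos : 0 < v j := by by_contra! h'; nlinarith
    nlinarith
  rw [← hvi]
  refine abs_le_of_sq_le_sq ?_ (by positivity)
  have := h3 i
  have h5 : μ * (v i) ^ 2 ≤ μ * (μ⁻¹) ^ 2 := by
    rw [sq (μ⁻¹), mul_inv_cancel_left₀ hμ.ne']
    nlinarith
  exact le_of_mul_le_mul_left h5 hμ

theorem integrable_of_memLp_top {f : ℝ → ℝ} (h : MemLp f ⊤ (lebIcc a b)) :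
    Integrable f (lebIcc a b) := by
  have : IsFiniteMeasure (lebIcc a b) := by unfold lebIcc; infer_instance
  exact h.integrable le_top

theorem integrable_inv_P (E : SLEquation d a b) (i j : Fin d) :
    Integrable (fun t => (E.P t)⁻¹ i j) (lebIcc a b) := by
  obtain ⟨μ₁, h0, h⟩ | ⟨-, h⟩ := E.P_pos_or_invertible
  · have : IsFiniteMeasure (lebIcc a b) := by unfold lebIcc; infer_instance
    refine Integrable.of_bound (C := μ₁⁻¹) ?_ (h.mono fun t ht => abs_inv_apply_le h0 ht i j)
    -- Measurability of the inverse comes from Cramer's rule, as determinant and adjugate are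
    -- continuous.
    have hP : AEMeasurable (fun t i j => E.P t i j) (lebIcc a b) :=
      aemeasurable_pi_lambda _ fun i => aemeasurable_pi_lambda _ fun j => (E.P_bdd i j).1.aemeasurable
    have hdet : Continuous fun M : Fin d → Fin d → ℝ => (Matrix.of M).det :=
      Continuous.matrix_det continuous_id
    have hadj : Continuous fun M : Fin d → Fin d → ℝ => (Matrix.of M).adjugate i j :=
      (Continuous.matrix_adjugate (A := fun M : Fin d → Fin d → ℝ => Matrix.of M)
        continuous_id).matrix_elem i j
    have := ((hdet.measurable.comp_aemeasurable hP).inv.mul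
      (hadj.measurable.comp_aemeasurable hP)).aestronglyMeasurable
    refine this.congr (Filter.Eventually.of_forall fun t => ?_)
    simp [Matrix.inv_def]
    rfl
  · exact h i j

/-- The map `(y, z) ↦ (U z, V y)`. -/
noncomputable def offDiag : ((Fin d → Fin d → ℂ) × (Fin d → Fin d → ℂ)) →ₗ[ℂ]
    ((Fin d → ℂ) × (Fin d → ℂ)) →L[ℂ] ((Fin d → ℂ) × (Fin d → ℂ)) where
  toFun M := LinearMap.toContinuousLinearMap
    (((Matrix.of M.1).mulVecLin ∘ₗ LinearMap.snd ℂ _ _).prod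
      ((Matrix.of M.2).mulVecLin ∘ₗ LinearMap.fst ℂ _ _))
  map_add' M N := by
    refine ContinuousLinearMap.ext fun x => Prod.ext ?_ ?_
    · exact Matrix.add_mulVec (Matrix.of M.1) (Matrix.of N.1) x.2
    · exact Matrix.add_mulVec (Matrix.of M.2) (Matrix.of N.2) x.1
  map_smul' c M := by
    refine ContinuousLinearMap.ext fun x => Prod.ext ?_ ?_
    · exact Matrix.smul_mulVec c (Matrix.of M.1) x.2
    · exact Matrix.smul_mulVec c (Matrix.of M.2) x.1

theorem intervalIntegrable_offDiag (hab : a ≤ b) {U V : ℝ → Fin d → Fin d → ℂ}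
    (hU : ∀ i j, Integrable (fun t => U t i j) (lebIcc a b))
    (hV : ∀ i j, Integrable (fun t => V t i j) (lebIcc a b)) :
    IntervalIntegrable (fun t => offDiag (U t, V t)) volume a b := by
  rw [intervalIntegrable_iff_integrableOn_Icc_of_le hab]
  exact (LinearMap.toContinuousLinearMap (offDiag (d := d))).integrable_comp
    ((Integrable.of_eval fun i => Integrable.of_eval fun j => hU i j).prodMk
      (Integrable.of_eval fun i => Integrable.of_eval fun j => hV i j))

/-- The part of the coefficient of the first order system that does not depend on `λ`. -/
noncomputable def coeff₀ (E : SLEquation d a b) (t : ℝ) :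
    ((Fin d → ℂ) × (Fin d → ℂ)) →L[ℂ] ((Fin d → ℂ) × (Fin d → ℂ)) :=
  offDiag (cplx (E.P t)⁻¹, cplx (E.Q t))

/-- The factor of `λ` in the coefficient of the first order system. -/
noncomputable def coeff₁ (E : SLEquation d a b) (t : ℝ) :
    ((Fin d → ℂ) × (Fin d → ℂ)) →L[ℂ] ((Fin d → ℂ) × (Fin d → ℂ)) :=
  offDiag (0, -cplx (E.W t))

theorem coeff₀_apply (E : SLEquation d a b) (t : ℝ) (x : (Fin d → ℂ) × (Fin d → ℂ)) :
    E.coeff₀ t x = (cplx (E.P t)⁻¹ *ᵥ x.2, cplx (E.Q t) *ᵥ x.1) := rfl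

theorem coeff₁_apply (E : SLEquation d a b) (t : ℝ) (x : (Fin d → ℂ) × (Fin d → ℂ)) :
    E.coeff₁ t x = (0, -(cplx (E.W t) *ᵥ x.1)) := by
  exact Prod.ext (Matrix.zero_mulVec x.2) (Matrix.neg_mulVec x.1 (cplx (E.W t)))

theorem intervalIntegrable_coeff₀ (E : SLEquation d a b) :
    IntervalIntegrable E.coeff₀ volume a b :=
  intervalIntegrable_offDiag E.lt.le (fun i j => (E.integrable_inv_P i j).ofReal)
    fun i j => (integrable_of_memLp_top (E.Q_bdd i j)).ofReal

theorem intervalIntegrable_coeff₁ (E : SLEquation d a b) :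
    IntervalIntegrable E.coeff₁ volume a b :=
  intervalIntegrable_offDiag E.lt.le (fun _ _ => integrable_zero _ _ _)
    fun i j => (integrable_of_memLp_top (E.W_bdd i j)).ofReal.neg

/-- The Volterra operator of the first order system for `λ = 0`. -/
noncomputable def volterra₀ (E : SLEquation d a b) :=
  volterra E.lt.le E.intervalIntegrable_coeff₀

/-- The factor of `λ` in the Volterra operator of the first order system. -/
noncomputable def volterra₁ (E : SLEquation d a b) :=
  volterra E.lt.le E.intervalIntegrable_coeff₁

/-- The pencil is itself the Volterra operator with kernel `coeff₀ + lam • coeff₁`. -/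
theorem isUnit_one_sub (E : SLEquation d a b) (lam : ℂ) :
    IsUnit (1 - (E.volterra₀ + lam • E.volterra₁)) := by
  have hK : IntervalIntegrable (fun t => E.coeff₀ t + lam • E.coeff₁ t) volume a b :=
    E.intervalIntegrable_coeff₀.add (E.intervalIntegrable_coeff₁.smul lam)
  convert isUnit_one_sub_volterra E.lt.le hK using 2
  ext1 f
  ext1 t
  have h0 := (intervalIntegrable_clm_apply E.lt.le E.intervalIntegrable_coeff₀ f).mono_Icc t
  have h1 := (intervalIntegrable_clm_apply E.lt.le E.intervalIntegrable_coeff₁ f).mono_Icc t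
  change (∫ s in a..t, E.coeff₀ s (f (Set.projIcc a b E.lt.le s))) +
    lam • (∫ s in a..t, E.coeff₁ s (f (Set.projIcc a b E.lt.le s))) =
    ∫ s in a..t, (E.coeff₀ s + lam • E.coeff₁ s) (f (Set.projIcc a b E.lt.le s))
  rw [← intervalIntegral.integral_smul]
  exact (intervalIntegral.integral_add h0 (h1.smul lam)).symm

/-- The solution of the first order system with the given initial value, on `[a, b]`. -/
noncomputable def sol (E : SLEquation d a b) (lam : ℂ) (c : (Fin d → ℂ) × (Fin d → ℂ)) :
    C(Set.Icc a b, (Fin d → ℂ) × (Fin d → ℂ)) :=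
  pencilSol E.volterra₀ E.volterra₁ lam (ContinuousMap.const _ c)

theorem sol_eq (E : SLEquation d a b) (lam : ℂ) (c : (Fin d → ℂ) × (Fin d → ℂ)) :
    E.sol lam c = ContinuousMap.const _ c +
      (E.volterra₀ (E.sol lam c) + lam • E.volterra₁ (E.sol lam c)) :=
  pencilSol_eq (E.isUnit_one_sub lam) _

theorem analyticAt_sol (E : SLEquation d a b) (lam : ℂ) (c : (Fin d → ℂ) × (Fin d → ℂ)) :
    AnalyticAt ℂ (fun l => E.sol l c) lam :=
  analyticAt_pencilSol (E.isUnit_one_sub lam) _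

/-- The pair `(y, z)` of functions on the line extending a continuous function on `[a, b]`. -/
noncomputable def extend (E : SLEquation d a b)
    (x : C(Set.Icc a b, (Fin d → ℂ) × (Fin d → ℂ))) (t : ℝ) : (Fin d → ℂ) × (Fin d → ℂ) :=
  x (Set.projIcc a b E.lt.le t)

theorem extend_of_mem (E : SLEquation d a b) (x : C(Set.Icc a b, (Fin d → ℂ) × (Fin d → ℂ)))
    {t : ℝ} (ht : t ∈ Set.Icc a b) : E.extend x t = x ⟨t, ht⟩ := by
  rw [extend, Set.projIcc_of_mem]

theorem extend_left (E : SLEquation d a b) (x : C(Set.Icc a b, (Fin d → ℂ) × (Fin d → ℂ))) :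
    E.extend x a = x ⟨a, Set.left_mem_Icc.2 E.lt.le⟩ := E.extend_of_mem x _

theorem extend_right (E : SLEquation d a b) (x : C(Set.Icc a b, (Fin d → ℂ) × (Fin d → ℂ))) :
    E.extend x b = x ⟨b, Set.right_mem_Icc.2 E.lt.le⟩ := E.extend_of_mem x _

theorem ae_lebIcc_of_ae_uIcc (E : SLEquation d a b) {p : ℝ → Prop}
    (h : ∀ᵐ t, t ∈ Set.uIcc a b → p t) : ∀ᵐ t ∂lebIcc a b, p t := by
  rw [lebIcc, ae_restrict_iff' measurableSet_Icc]
  rwa [Set.uIcc_of_le E.lt.le] at h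

theorem ae_uIcc_of_ae_lebIcc (E : SLEquation d a b) {p : ℝ → Prop}
    (h : ∀ᵐ t ∂lebIcc a b, p t) : ∀ᵐ t, t ∈ Set.uIcc a b → p t := by
  rw [lebIcc, ae_restrict_iff' measurableSet_Icc] at h
  rwa [Set.uIcc_of_le E.lt.le]

theorem cplx_mul (M N : Matrix (Fin d) (Fin d) ℝ) : cplx (M * N) = cplx M * cplx N :=
  Matrix.map_mul (f := Complex.ofRealHom)

theorem cplx_one : cplx (1 : Matrix (Fin d) (Fin d) ℝ) = 1 := by
  simp [cplx]

theorem cplx_inv_mul {M : Matrix (Fin d) (Fin d) ℝ} (h : IsUnit M) : cplx M⁻¹ * cplx M = 1 := by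
  rw [← cplx_mul, Matrix.nonsing_inv_mul _ ((Matrix.isUnit_iff_isUnit_det M).1 h), cplx_one]

theorem cplx_mul_inv {M : Matrix (Fin d) (Fin d) ℝ} (h : IsUnit M) : cplx M * cplx M⁻¹ = 1 := by
  rw [← cplx_mul, Matrix.mul_nonsing_inv _ ((Matrix.isUnit_iff_isUnit_det M).1 h), cplx_one]

theorem inv_cplx {M : Matrix (Fin d) (Fin d) ℝ} (h : IsUnit M) : (cplx M)⁻¹ = cplx M⁻¹ :=
  Matrix.inv_eq_left_inv (cplx_inv_mul h)

/-- A solution `x` of the Volterra equation with inhomogeneity `W G` yields a solution of the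
inhomogeneous Sturm-Liouville equation. -/
theorem isQuasiPair_extend (E : SLEquation d a b) {lam : ℂ} {c : (Fin d → ℂ) × (Fin d → ℂ)}
    {x G : C(Set.Icc a b, (Fin d → ℂ) × (Fin d → ℂ))}
    (h : x = ContinuousMap.const _ c + (E.volterra₀ x + lam • E.volterra₁ x + E.volterra₁ G)) :
    E.IsQuasiPair (fun t => (E.extend x t).1) (fun t => (E.extend x t).2) ∧
      ∀ᵐ t ∂lebIcc a b, E.expr (fun t => (E.extend x t).1) (fun t => (E.extend x t).2) t =
        cplx (E.W t) *ᵥ (lam • (E.extend x t).1 + (E.extend G t).1) := by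
  set k : ℝ → (Fin d → ℂ) × (Fin d → ℂ) := fun s => E.coeff₀ s (E.extend x s) +
    lam • E.coeff₁ s (E.extend x s) + E.coeff₁ s (E.extend G s) with hk
  have i0 : IntervalIntegrable (fun s => E.coeff₀ s (E.extend x s)) volume a b :=
    intervalIntegrable_clm_apply E.lt.le E.intervalIntegrable_coeff₀ x
  have i1 : ∀ x, IntervalIntegrable (fun s => E.coeff₁ s (E.extend x s)) volume a b := fun x =>
    intervalIntegrable_clm_apply E.lt.le E.intervalIntegrable_coeff₁ x
  have ik : IntervalIntegrable k volume a b := (i0.add ((i1 x).smul lam)).add (i1 G)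
  have hx : ∀ t ∈ Set.Icc a b, c + ∫ s in a..t, k s = E.extend x t := by
    intro t ht
    have e := DFunLike.congr_fun h ⟨t, ht⟩
    rw [E.extend_of_mem x ht, e]
    have j0 := i0.mono_Icc ⟨t, ht⟩
    have j1 := fun x => (i1 x).mono_Icc ⟨t, ht⟩
    have e1 : ∫ s in a..t, k s = (∫ s in a..t, E.coeff₀ s (E.extend x s)) +
        lam • (∫ s in a..t, E.coeff₁ s (E.extend x s)) +
        ∫ s in a..t, E.coeff₁ s (E.extend G s) := by
      rw [← intervalIntegral.integral_smul]
      exact (intervalIntegral.integral_add (j0.add ((j1 x).smul lam)) (j1 G)).trans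
        (congrArg (· + _) (intervalIntegral.integral_add j0 ((j1 x).smul lam)))
    rw [e1]
    rfl
  have hac : AbsolutelyContinuousOnInterval (E.extend x) a b := by
    refine (ik.absolutelyContinuousOnInterval_primitive.of_dist_le (f := fun t =>
      c + ∫ s in a..t, k s) fun s _ t _ => by simp).congr ?_
    rw [Set.uIcc_of_le E.lt.le]
    exact hx
  have hd : ∀ᵐ t ∂lebIcc a b, HasDerivAt (E.extend x) (k t) t := by
    filter_upwards [E.ae_lebIcc_of_ae_uIcc ik.ae_hasDerivAt_integral, ae_mem_Ioo a b] with t h1 hm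
    refine ((h1 a Set.left_mem_uIcc).const_add c).congr_of_eventuallyEq ?_
    -- The integral representation holds only on `[a, b]`, so the derivative is taken at interior
    -- points.
    filter_upwards [Icc_mem_nhds hm.1 hm.2] with s hs using (hx s hs).symm
  have hd1 : ∀ᵐ t ∂lebIcc a b, deriv (fun t => (E.extend x t).1) t = (k t).1 := by
    filter_upwards [hd] with t ht using (hasFDerivAt_fst.comp_hasDerivAt t ht).deriv
  have hd2 : ∀ᵐ t ∂lebIcc a b, deriv (fun t => (E.extend x t).2) t = (k t).2 := by
    filter_upwards [hd] with t ht using (hasFDerivAt_snd.comp_hasDerivAt t ht).deriv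
  refine ⟨⟨hac.clm_comp (ContinuousLinearMap.fst ℂ _ _),
    hac.clm_comp (ContinuousLinearMap.snd ℂ _ _), ?_⟩, ?_⟩
  · filter_upwards [hd1, E.ae_isUnit_P] with t h1 hP
    rw [h1]
    simp [hk, coeff₀_apply, coeff₁_apply, Matrix.mulVec_mulVec, cplx_mul_inv hP]
  · filter_upwards [hd2] with t h2
    rw [expr, h2]
    simp only [hk, coeff₀_apply, coeff₁_apply, Prod.snd_add, Prod.smul_snd, Matrix.mulVec_add,
      Matrix.mulVec_smul, smul_neg]
    abel

/-- Uniqueness: integrating the system turns any solution into a fixed point of the Volterra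
equation, which has only one. -/
theorem IsSolution.eq_sol {E : SLEquation d a b} {lam : ℂ} {y z : ℝ → Fin d → ℂ}
    (h : E.IsSolution lam y z) {t : ℝ} (ht : t ∈ Set.Icc a b) :
    (y t, z t) = E.sol lam (y a, z a) ⟨t, ht⟩ := by
  obtain ⟨⟨hy, hz, hP⟩, he⟩ := h
  have hac := hy.prodMk hz
  have hIcc := Set.uIcc_of_le E.lt.le
  let x : C(Set.Icc a b, (Fin d → ℂ) × (Fin d → ℂ)) :=
    ⟨fun t => (y t, z t), (hIcc ▸ hac.continuousOn).domRestrict⟩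
  have hx : ∀ t ∈ Set.Icc a b, E.extend x t = (y t, z t) := fun t ht => E.extend_of_mem x ht
  have i0 : IntervalIntegrable (fun s => E.coeff₀ s (E.extend x s)) volume a b :=
    intervalIntegrable_clm_apply E.lt.le E.intervalIntegrable_coeff₀ x
  have i1 : IntervalIntegrable (fun s => E.coeff₁ s (E.extend x s)) volume a b :=
    intervalIntegrable_clm_apply E.lt.le E.intervalIntegrable_coeff₁ x
  have hd : ∀ᵐ t ∂lebIcc a b, HasDerivAt (fun t => (y t, z t))
      (E.coeff₀ t (E.extend x t) + lam • E.coeff₁ t (E.extend x t)) t := by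
    filter_upwards [ae_differentiableAt hy, ae_differentiableAt hz, hP, he, E.ae_isUnit_P,
      ae_mem_Ioo a b] with t d1 d2 hP he hu hm
    refine (d1.hasDerivAt.prodMk d2.hasDerivAt).congr_deriv ?_
    rw [hx t (Set.Ioo_subset_Icc_self hm), coeff₀_apply, coeff₁_apply]
    refine Prod.ext ?_ ?_
    · simp [hP, Matrix.mulVec_mulVec, cplx_inv_mul hu]
    · rw [expr, neg_add_eq_iff_eq_add] at he
      simp [he]
  have key : x = ContinuousMap.const _ (y a, z a) + (E.volterra₀ x + lam • E.volterra₁ x) := by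
    ext1 s
    have := hac.eq_add_integral (i0.add (i1.smul lam)) (E.ae_uIcc_of_ae_lebIcc hd)
      (Set.Icc_subset_uIcc s.2)
    have e1 := intervalIntegral.integral_add (i0.mono_Icc s) ((i1.smul lam).mono_Icc s)
    have e2 := intervalIntegral.integral_smul (μ := volume) (a := a) (b := s) lam
      fun s => E.coeff₁ s (E.extend x s)
    exact this.trans (congrArg ((y a, z a) + ·) (e1.trans (congrArg (_ + ·) e2)))
  exact DFunLike.congr_fun (eq_pencilSol (E.isUnit_one_sub lam) key) ⟨t, ht⟩

theorem isSolution_extend_sol (E : SLEquation d a b) (lam : ℂ) (c : (Fin d → ℂ) × (Fin d → ℂ)) :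
    E.IsSolution lam (fun t => (E.extend (E.sol lam c) t).1)
      (fun t => (E.extend (E.sol lam c) t).2) := by
  have h : E.sol lam c = ContinuousMap.const _ c +
      (E.volterra₀ (E.sol lam c) + lam • E.volterra₁ (E.sol lam c) + E.volterra₁ 0) := by
    rw [map_zero, add_zero]
    exact E.sol_eq lam c
  obtain ⟨h1, h2⟩ := E.isQuasiPair_extend h
  refine ⟨h1, h2.mono fun t ht => ?_⟩
  rw [ht, ← Matrix.mulVec_smul]
  simp [extend]

theorem sol_left (E : SLEquation d a b) (lam : ℂ) (c : (Fin d → ℂ) × (Fin d → ℂ)) :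
    E.sol lam c ⟨a, Set.left_mem_Icc.2 E.lt.le⟩ = c := by
  rw [E.sol_eq]
  simp [volterra₀, volterra₁]

end SLEquation

/-! ### Self-adjoint boundary conditions, Green's formula and symmetry. -/

theorem AbsolutelyContinuousOnInterval.fun_finset_sum {ι F : Type*} [SeminormedAddCommGroup F]
    {f : ι → ℝ → F} {a b : ℝ} (s : Finset ι)
    (h : ∀ i ∈ s, AbsolutelyContinuousOnInterval (f i) a b) :
    AbsolutelyContinuousOnInterval (fun t => ∑ i ∈ s, f i t) a b := by
  classical
  induction s using Finset.induction_on with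
  | empty =>
    have := (LipschitzWith.const (α := ℝ) (0 : F)).lipschitzOnWith (s := Set.uIcc a b)
    simpa using this.absolutelyContinuousOnInterval
  | insert i s hi ih =>
    simp only [Finset.sum_insert hi]
    exact (h i (Finset.mem_insert_self _ _)).fun_add
      (ih fun j hj => h j (Finset.mem_insert_of_mem hj))

theorem AbsolutelyContinuousOnInterval.star_dotProduct {ι : Type*} [Fintype ι]
    {v u : ℝ → ι → ℂ} {a b : ℝ} (hv : AbsolutelyContinuousOnInterval v a b)
    (hu : AbsolutelyContinuousOnInterval u a b) :
    AbsolutelyContinuousOnInterval (fun t => star (v t) ⬝ᵥ u t) a b := by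
  refine AbsolutelyContinuousOnInterval.fun_finset_sum _ fun i _ => ?_
  have h1 := (hv.clm_comp (ContinuousLinearMap.proj (R := ℝ) i)).clm_comp
    (Complex.conjCLE : ℂ →L[ℝ] ℂ)
  exact h1.fun_smul (hu.clm_comp (ContinuousLinearMap.proj (R := ℝ) i))

theorem HasDerivAt.star_dotProduct {ι : Type*} [Fintype ι] {v u : ℝ → ι → ℂ} {v' u' : ι → ℂ} {t : ℝ}
    (hv : HasDerivAt v v' t) (hu : HasDerivAt u u' t) :
    HasDerivAt (fun t => star (v t) ⬝ᵥ u t) (star v' ⬝ᵥ u t + star (v t) ⬝ᵥ u') t := by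
  simp only [dotProduct, ← Finset.sum_add_distrib]
  exact HasDerivAt.fun_sum fun i _ => (hasDerivAt_pi.1 hv i).star.mul (hasDerivAt_pi.1 hu i)

namespace SLBoundary

variable {d : ℕ}

/-- The boundary subspace is the range of `(B*; -A*)`. -/
theorem exists_eq_conjTranspose_mulVec (C : SLBoundary d) {X Z : Fin d ⊕ Fin d → ℂ}
    (h : C.A *ᵥ X + C.B *ᵥ Z = 0) : ∃ w, X = C.Bᴴ *ᵥ w ∧ Z = -(C.Aᴴ *ᵥ w) := by
  set G := Matrix.fromCols C.A C.B with hG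
  set N := Matrix.fromRows C.Bᴴ (-C.Aᴴ) with hN
  -- The inclusion is `A B* = B A*`; equality follows because both spaces have dimension `2d`, by
  -- the rank condition on `G` and on `Gᴴ`.
  have hle : LinearMap.range N.mulVecLin ≤ LinearMap.ker G.mulVecLin := by
    rintro _ ⟨w, rfl⟩
    rw [LinearMap.mem_ker, Matrix.mulVecLin_apply, Matrix.mulVecLin_apply, Matrix.mulVec_mulVec,
      hG, hN, Matrix.fromCols_mul_fromRows, Matrix.mul_neg, C.selfAdjoint, add_neg_cancel,
      Matrix.zero_mulVec]
  have hker : Module.finrank ℂ (LinearMap.ker G.mulVecLin) = 2 * d := by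
    have h1 := G.mulVecLin.finrank_range_add_finrank_ker
    have h2 : Module.finrank ℂ (LinearMap.range G.mulVecLin) = 2 * d := C.rank_eq
    simp only [Module.finrank_fintype_fun_eq_card, Fintype.card_sum, Fintype.card_fin] at h1
    omega
  have hinj : LinearMap.ker N.mulVecLin = ⊥ := by
    have h1 : LinearMap.ker Gᴴ.mulVecLin = ⊥ := by
      have h1 := Gᴴ.mulVecLin.finrank_range_add_finrank_ker
      have h2 : Module.finrank ℂ (LinearMap.range Gᴴ.mulVecLin) = 2 * d :=
        (open scoped ComplexOrder in Matrix.rank_conjTranspose G).trans C.rank_eq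
      simp only [Module.finrank_fintype_fun_eq_card, Fintype.card_sum, Fintype.card_fin] at h1
      exact Submodule.finrank_eq_zero.1 (by omega)
    rw [eq_bot_iff, ← h1]
    intro w hw
    rw [LinearMap.mem_ker, Matrix.mulVecLin_apply, hN, Matrix.fromRows_mulVec] at hw
    have k1 : C.Bᴴ *ᵥ w = 0 := funext fun i => congrFun hw (Sum.inl i)
    have k2 : C.Aᴴ *ᵥ w = 0 := by
      have : (-C.Aᴴ) *ᵥ w = 0 := funext fun i => congrFun hw (Sum.inr i)
      rwa [Matrix.neg_mulVec, neg_eq_zero] at this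
    rw [LinearMap.mem_ker, Matrix.mulVecLin_apply, hG,
      Matrix.conjTranspose_fromCols_eq_fromRows_conjTranspose, Matrix.fromRows_mulVec, k1, k2]
    ext i
    cases i <;> rfl
  have hrange : LinearMap.range N.mulVecLin = LinearMap.ker G.mulVecLin := by
    refine Submodule.eq_of_le_of_finrank_eq hle ?_
    rw [hker, LinearMap.finrank_range_of_inj (LinearMap.ker_eq_bot.1 hinj),
      Module.finrank_fintype_fun_eq_card, Fintype.card_sum, Fintype.card_fin]
    ring
  have hmem : Sum.elim X Z ∈ LinearMap.ker G.mulVecLin := by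
    rw [LinearMap.mem_ker, Matrix.mulVecLin_apply, hG, Matrix.fromCols_mulVec]
    exact h
  rw [← hrange] at hmem
  obtain ⟨w, hw⟩ := hmem
  rw [Matrix.mulVecLin_apply, hN, Matrix.fromRows_mulVec, Matrix.neg_mulVec] at hw
  exact ⟨w, funext fun i => (congrFun hw (Sum.inl i)).symm,
    funext fun i => (congrFun hw (Sum.inr i)).symm⟩

/-- In the parametrization by `w` and `w'` the two sides are `-w'* A B* w` and `-w'* B A* w`. -/
theorem star_dotProduct_eq (C : SLBoundary d) {X Z X' Z' : Fin d ⊕ Fin d → ℂ}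
    (h : C.A *ᵥ X + C.B *ᵥ Z = 0) (h' : C.A *ᵥ X' + C.B *ᵥ Z' = 0) :
    star Z' ⬝ᵥ X = star X' ⬝ᵥ Z := by
  obtain ⟨w, rfl, rfl⟩ := C.exists_eq_conjTranspose_mulVec h
  obtain ⟨w', rfl, rfl⟩ := C.exists_eq_conjTranspose_mulVec h'
  rw [star_neg, Matrix.star_mulVec, Matrix.star_mulVec, Matrix.conjTranspose_conjTranspose,
    Matrix.conjTranspose_conjTranspose, neg_dotProduct, dotProduct_neg,
    ← Matrix.dotProduct_mulVec, ← Matrix.dotProduct_mulVec, Matrix.mulVec_mulVec,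
    Matrix.mulVec_mulVec, C.selfAdjoint]

end SLBoundary

namespace SLEquation

variable {d : ℕ} {a b : ℝ}

theorem star_cplx_mulVec_dotProduct {M : Matrix (Fin d) (Fin d) ℝ} (h : M.IsSymm)
    (v w : Fin d → ℂ) : star (cplx M *ᵥ v) ⬝ᵥ w = star v ⬝ᵥ (cplx M *ᵥ w) := by
  have : (cplx M)ᴴ = cplx M := by
    ext i j
    simp [cplx, h.apply i j]
  rw [Matrix.star_mulVec, this, Matrix.dotProduct_mulVec]

/-- Green's formula: the operator is symmetric. -/
theorem integral_form_sub_eq_zero {E : SLEquation d a b} {C : SLBoundary d} {u f v g : E.L2W}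
    (huf : (u, f) ∈ E.graph C) (hvg : (v, g) ∈ E.graph C) :
    ∫ t, (star (v.1 t) ⬝ᵥ (cplx (E.W t) *ᵥ f.1 t) - star (g.1 t) ⬝ᵥ (cplx (E.W t) *ᵥ u.1 t))
      ∂lebIcc a b = 0 := by
  obtain ⟨y, z, h, hb, hu, hf⟩ := huf
  obtain ⟨y', z', h', hb', hv, hg⟩ := hvg
  set G : ℝ → ℂ := fun t => star (deriv z' t) ⬝ᵥ y t - star (y' t) ⬝ᵥ deriv z t with hG
  have hac : AbsolutelyContinuousOnInterval
      (fun t => star (z' t) ⬝ᵥ y t - star (y' t) ⬝ᵥ z t) a b :=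
    (h'.ac_quasi.star_dotProduct h.ac).fun_sub (h'.ac.star_dotProduct h.ac_quasi)
  have hd : ∀ᵐ t ∂lebIcc a b, HasDerivAt
      (fun t => star (z' t) ⬝ᵥ y t - star (y' t) ⬝ᵥ z t) (G t) t := by
    filter_upwards [ae_differentiableAt h.ac, ae_differentiableAt h.ac_quasi,
      ae_differentiableAt h'.ac, ae_differentiableAt h'.ac_quasi, h.eq, h'.eq, E.P_symm]
      with t d1 d2 d3 d4 e e' hP
    refine ((d4.hasDerivAt.star_dotProduct d1.hasDerivAt).sub
      (d3.hasDerivAt.star_dotProduct d2.hasDerivAt)).congr_deriv ?_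
    -- The two terms pairing `deriv y'` with `deriv y` through `P` cancel because `P` is symmetric.
    rw [hG, e, e', star_cplx_mulVec_dotProduct hP]
    ring
  have hd' := E.ae_uIcc_of_ae_lebIcc hd
  have key := hac.eq_add_integral (hac.intervalIntegrable_of_ae_hasDerivAt hd') hd'
    Set.right_mem_uIcc
  -- Owing to the sign in `-y a`, this says that the bracket takes the same value at `a` and at `b`.
  have hbd := C.star_dotProduct_eq hb hb'
  have hint : ∫ t in a..b, G t = 0 := by
    simp only [dotProduct, Fintype.sum_sum_type, Pi.star_apply, Sum.elim_inl, Sum.elim_inr,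
      Pi.neg_apply, star_neg, mul_neg, neg_mul, Finset.sum_neg_distrib] at hbd key
    linear_combination -key + hbd
  rw [intervalIntegral.integral_of_le E.lt.le, ← integral_Icc_eq_integral_Ioc] at hint
  rw [← hint]
  refine integral_congr_ae ?_
  filter_upwards [hu, hf, hv, hg, E.ae_isUnit_W, E.W_symm, E.Q_symm] with t hu hf hv hg hW hWs hQ
  rw [← star_cplx_mulVec_dotProduct hWs (g.1 t), hu, hf, hv, hg, inv_cplx hW, Matrix.mulVec_mulVec,
    Matrix.mulVec_mulVec, cplx_mul_inv hW, Matrix.one_mulVec, Matrix.one_mulVec, expr, expr,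
    star_add, add_dotProduct, dotProduct_add, star_cplx_mulVec_dotProduct hQ, star_neg,
    neg_dotProduct, dotProduct_neg, hG]
  ring

/-- The form of `L²_W` is positive definite. -/
theorem eq_zero_of_integral_form_eq_zero {E : SLEquation d a b} {u : E.L2W}
    (h : ∫ t, star (u.1 t) ⬝ᵥ (cplx (E.W t) *ᵥ u.1 t) ∂lebIcc a b = 0) : u = 0 := by
  have hre : ∀ᵐ t ∂lebIcc a b,
      0 ≤ (star (u.1 t) ⬝ᵥ (cplx (E.W t) *ᵥ u.1 t)).re ∧
      ((star (u.1 t) ⬝ᵥ (cplx (E.W t) *ᵥ u.1 t)).re = 0 → u.1 t = 0) := by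
    filter_upwards [E.W_posSemidef, E.ae_isUnit_W] with t hW hu
    obtain ⟨N, hN⟩ := form_eq hW
    have hsum : star (u.1 t) ⬝ᵥ (cplx (E.W t) *ᵥ u.1 t) =
        ((∑ i, ‖(N *ᵥ u.1 t) i‖ ^ 2 : ℝ) : ℂ) := by
      rw [hN]
      simp [dotProduct, Complex.conj_mul']
    rw [hsum, Complex.ofReal_re]
    refine ⟨by positivity, fun h0 => ?_⟩
    have hNu : N *ᵥ u.1 t = 0 := by
      rw [Finset.sum_eq_zero_iff_of_nonneg fun i _ => by positivity] at h0
      ext i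
      simpa using h0 i (Finset.mem_univ i)
    have hWu : cplx (E.W t) *ᵥ u.1 t = 0 := by
      -- Pairing `W u` with itself through the factorization gives `|W u|² = ⟨N W u, N u⟩ = 0`.
      have := hN (cplx (E.W t) *ᵥ u.1 t) (u.1 t)
      rw [hNu, dotProduct_zero] at this
      have h2 := norm_star_dot (cplx (E.W t) *ᵥ u.1 t)
      rw [this, norm_zero, eq_comm, Finset.sum_eq_zero_iff_of_nonneg fun i _ => by positivity] at h2
      ext i
      simpa using h2 i (Finset.mem_univ i)
    rw [← Matrix.one_mulVec (u.1 t), ← cplx_inv_mul hu, ← Matrix.mulVec_mulVec, hWu,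
      Matrix.mulVec_zero]
  have hi : Integrable (fun t => star (u.1 t) ⬝ᵥ (cplx (E.W t) *ᵥ u.1 t)) (lebIcc a b) := u.2
  have h1 : ∫ t, (star (u.1 t) ⬝ᵥ (cplx (E.W t) *ᵥ u.1 t)).re ∂lebIcc a b = 0 := by
    have := integral_re hi
    simpa [h] using this
  rw [integral_eq_zero_iff_of_nonneg_ae (hre.mono fun t ht => ht.1) hi.re] at h1
  refine Subtype.ext (AEEqFun.ext ?_)
  refine Filter.EventuallyEq.trans ?_
    (AEEqFun.coeFn_zero (μ := lebIcc a b) (α := ℝ) (β := Fin d → ℂ)).symm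
  filter_upwards [h1, hre] with t h1 h2 using h2.2 h1

/-- Green's formula for `u` against itself reads `(λ - conj λ) ⟨u, u⟩ = 0`. -/
theorem conj_eq_of_mem_graph {E : SLEquation d a b} {C : SLBoundary d} {lam : ℂ} {u : E.L2W}
    (h : (u, lam • u) ∈ E.graph C) (hu : u ≠ 0) : star lam = lam := by
  have h1 := integral_form_sub_eq_zero h h
  by_contra hne
  refine hu (eq_zero_of_integral_form_eq_zero ?_)
  have h2 : ∫ t, (lam - star lam) * (star (u.1 t) ⬝ᵥ (cplx (E.W t) *ᵥ u.1 t)) ∂lebIcc a b = 0 := by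
    rw [← h1]
    refine integral_congr_ae ?_
    filter_upwards [AEEqFun.coeFn_smul lam u.1] with t ht
    change _ = _ - star ((lam • u.1 : ℝ →ₘ[lebIcc a b] (Fin d → ℂ)) t) ⬝ᵥ _
    change _ = star (u.1 t) ⬝ᵥ (_ *ᵥ (lam • u.1 : ℝ →ₘ[lebIcc a b] (Fin d → ℂ)) t) - _
    rw [ht, Pi.smul_apply, Matrix.mulVec_smul, star_smul, dotProduct_smul, smul_dotProduct,
      smul_eq_mul, smul_eq_mul]
    ring
  rw [integral_const_mul] at h2
  exact (mul_eq_zero.1 h2).resolve_left fun h => hne (sub_eq_zero.1 h).symm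

/-- A nonzero eigenfunction for a real `λ` is not in the range of `T - λ`. -/
theorem eq_zero_of_mem_graph {E : SLEquation d a b} {C : SLBoundary d} {lam : ℂ}
    (hlam : star lam = lam) {u f : E.L2W} (hu : (u, lam • u + f) ∈ E.graph C)
    (hf : (f, lam • f) ∈ E.graph C) : f = 0 := by
  refine eq_zero_of_integral_form_eq_zero ?_
  -- The two terms containing `lam` cancel because `lam` is real, leaving only the form of `f`.
  rw [← integral_form_sub_eq_zero hu hf]
  refine integral_congr_ae ?_
  filter_upwards [AEEqFun.coeFn_smul lam u.1, AEEqFun.coeFn_smul lam f.1,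
    AEEqFun.coeFn_add (lam • u.1) f.1] with t h1 h2 h3
  change _ = star (f.1 t) ⬝ᵥ (_ *ᵥ (lam • u.1 + f.1 : ℝ →ₘ[lebIcc a b] (Fin d → ℂ)) t) -
    star ((lam • f.1 : ℝ →ₘ[lebIcc a b] (Fin d → ℂ)) t) ⬝ᵥ _
  rw [h3, Pi.add_apply, h1, h2, Pi.smul_apply, Pi.smul_apply, Matrix.mulVec_add,
    Matrix.mulVec_smul, star_smul, dotProduct_add, dotProduct_smul, smul_dotProduct, hlam]
  ring

end SLEquation

/-! ### Root spaces without Jordan chains. -/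

theorem LinearPMap.mem_eigenspace_iff {H : Type*} [AddCommGroup H] [Module ℂ H]
    (T : H →ₗ.[ℂ] H) {lam : ℂ} {u : H} : u ∈ T.eigenspace lam ↔ (u, lam • u) ∈ T.graph := by
  rw [LinearPMap.mem_graph_iff]
  constructor
  · rintro ⟨h, e⟩
    exact ⟨⟨u, h⟩, rfl, e⟩
  · rintro ⟨⟨v, hv⟩, rfl, e⟩
    exact ⟨hv, e⟩

/-- If no nonzero eigenvector lies in the range of `T - λ`, the root space is the eigenspace. -/
theorem LinearPMap.rootSpace_eq_eigenspace {H : Type*} [AddCommGroup H] [Module ℂ H]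
    (T : H →ₗ.[ℂ] H) {lam : ℂ}
    (h : ∀ u f, (u, lam • u + f) ∈ T.graph → (f, lam • f) ∈ T.graph → f = 0) :
    T.rootSpace lam = T.eigenspace lam := by
  have key : ∀ k, T.kerPow lam k ≤ T.eigenspace lam := by
    intro k
    induction k with
    | zero => exact bot_le
    | succ k ih =>
      intro u hu
      obtain ⟨hd, hu⟩ := (T.mem_kerPow_succ lam k u).1 hu
      -- The vector `(T - λ) u` is in the range of `T - λ` and, by induction, in the eigenspace.
      have h0 := h u (T ⟨u, hd⟩ - lam • u)
        ((T.mem_graph_iff).2 ⟨⟨u, hd⟩, rfl, by simp⟩) (T.mem_eigenspace_iff.1 (ih hu))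
      exact ⟨hd, sub_eq_zero.1 h0⟩
  refine le_antisymm (fun u ⟨k, _, hu⟩ => key k hu) fun u ⟨hd, hu⟩ => ⟨1, le_rfl, ?_⟩
  rw [T.mem_kerPow_succ]
  exact ⟨hd, by rw [hu, sub_self]; exact zero_mem _⟩

/-! ### Eigenfunctions and `Γ` in terms of initial vectors. -/

/-- The boundary form `A (-y(a); y(b)) + B (z(a); z(b))` as a continuous linear map. -/
noncomputable def SLBoundary.form {d : ℕ} (C : SLBoundary d) {a b : ℝ} (hab : a ≤ b) :
    C(Set.Icc a b, (Fin d → ℂ) × (Fin d → ℂ)) →L[ℂ] (Fin d ⊕ Fin d → ℂ) where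
  toFun x := C.A *ᵥ Sum.elim (-(x ⟨a, Set.left_mem_Icc.2 hab⟩).1)
      (x ⟨b, Set.right_mem_Icc.2 hab⟩).1 +
    C.B *ᵥ Sum.elim (x ⟨a, Set.left_mem_Icc.2 hab⟩).2 (x ⟨b, Set.right_mem_Icc.2 hab⟩).2
  map_add' x y := by
    rw [add_add_add_comm, ← Matrix.mulVec_add, ← Matrix.mulVec_add]
    congr 2 <;> ext i <;> cases i <;> simp [add_comm]
  map_smul' c x := by
    rw [RingHom.id_apply, smul_add, ← Matrix.mulVec_smul, ← Matrix.mulVec_smul]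
    congr 2 <;> ext i <;> cases i <;> simp
  cont := by
    have h := fun t : Set.Icc a b => ContinuousEvalConst.continuous_eval_const
      (F := C(Set.Icc a b, (Fin d → ℂ) × (Fin d → ℂ))) t
    refine (continuous_const.matrix_mulVec (continuous_pi ?_)).add
      (continuous_const.matrix_mulVec (continuous_pi ?_))
    · rintro (i | i)
      · exact (continuous_apply i).comp (h _).fst.neg
      · exact (continuous_apply i).comp (h _).fst
    · rintro (i | i)
      · exact (continuous_apply i).comp (h _).snd
      · exact (continuous_apply i).comp (h _).snd

namespace SLEquation

variable {d : ℕ} {a b : ℝ}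

theorem form_eq_zero_iff (E : SLEquation d a b) (C : SLBoundary d)
    (x : C(Set.Icc a b, (Fin d → ℂ) × (Fin d → ℂ))) :
    C.form E.lt.le x = 0 ↔
      C.Holds a b (fun t => (E.extend x t).1) (fun t => (E.extend x t).2) := by
  simp only [SLBoundary.Holds, extend_left, extend_right]
  rfl

/-- The class in `L²_W` of the first component of a continuous function. -/
noncomputable def toL2W (E : SLEquation d a b) :
    C(Set.Icc a b, (Fin d → ℂ) × (Fin d → ℂ)) →ₗ[ℂ] E.L2W where
  toFun x := ⟨AEEqFun.mk (fun t => (E.extend x t).1)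
      (x.continuous.comp continuous_projIcc).fst.aestronglyMeasurable, by
    have hc : Continuous fun t => (E.extend x t).1 := (x.continuous.comp continuous_projIcc).fst
    have hi : Integrable (fun t => star (E.extend x t).1 ⬝ᵥ (cplx (E.W t) *ᵥ (E.extend x t).1))
        (lebIcc a b) := by
      simp only [dotProduct, Matrix.mulVec, cplx, Matrix.map_apply]
      refine integrable_finsetSum _ fun i _ => ?_
      have h1 : Integrable (fun t => ∑ j, ((E.W t i j : ℝ) : ℂ) * (E.extend x t).1 j)
          (lebIcc a b) := integrable_finsetSum _ fun j _ =>
        IntegrableOn.mul_continuousOn (integrable_of_memLp_top (E.W_bdd i j)).ofReal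
          ((continuous_apply j).comp hc).continuousOn isCompact_Icc
      exact IntegrableOn.continuousOn_mul ((continuous_apply i).comp hc).star.continuousOn h1
        isCompact_Icc
    refine hi.congr ?_
    filter_upwards [AEEqFun.coeFn_mk (μ := lebIcc a b) _ hc.aestronglyMeasurable] with t ht
    rw [ht]⟩
  map_add' x y := rfl
  map_smul' c x := rfl

theorem coeFn_toL2W (E : SLEquation d a b) (x : C(Set.Icc a b, (Fin d → ℂ) × (Fin d → ℂ))) :
    (E.toL2W x).1 =ᵐ[lebIcc a b] fun t => (E.extend x t).1 :=
  AEEqFun.coeFn_mk _ _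

/-- In operator terms `(T - λ) x = G`. The case `G = 0` gives eigenfunctions; `G` an eigenfunction
serves the derivative of the solution in `λ`. -/
theorem mem_graph_of_eq (E : SLEquation d a b) (C : SLBoundary d) {lam : ℂ}
    {c : (Fin d → ℂ) × (Fin d → ℂ)} {x G : C(Set.Icc a b, (Fin d → ℂ) × (Fin d → ℂ))}
    (h : x = ContinuousMap.const _ c + (E.volterra₀ x + lam • E.volterra₁ x + E.volterra₁ G))
    (hx : C.form E.lt.le x = 0) :
    (E.toL2W x, lam • E.toL2W x + E.toL2W G) ∈ E.graph C := by
  obtain ⟨h1, h2⟩ := E.isQuasiPair_extend h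
  refine ⟨_, _, h1, (E.form_eq_zero_iff C x).1 hx, E.coeFn_toL2W x, ?_⟩
  filter_upwards [h2, E.ae_isUnit_W, E.coeFn_toL2W x, E.coeFn_toL2W G,
    AEEqFun.coeFn_smul lam (E.toL2W x).1,
    AEEqFun.coeFn_add (lam • (E.toL2W x).1) (E.toL2W G).1] with t ht hW e1 e2 e3 e4
  change (lam • (E.toL2W x).1 + (E.toL2W G).1 : ℝ →ₘ[lebIcc a b] (Fin d → ℂ)) t = _
  rw [ht, e4, Pi.add_apply, e3, Pi.smul_apply, e1, e2, inv_cplx hW, Matrix.mulVec_mulVec,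
    cplx_inv_mul hW, Matrix.one_mulVec]

/-- The solution of the homogeneous equation as a linear function of the initial vector. -/
noncomputable def solLin (E : SLEquation d a b) (lam : ℂ) :
    (Fin d ⊕ Fin d → ℂ) →ₗ[ℂ] C(Set.Icc a b, (Fin d → ℂ) × (Fin d → ℂ)) where
  toFun v := E.sol lam (fun i => v (Sum.inl i), fun i => v (Sum.inr i))
  map_add' v w := (pencilSol E.volterra₀ E.volterra₁ lam).map_add
    (ContinuousMap.const _ (fun i => v (Sum.inl i), fun i => v (Sum.inr i)))
    (ContinuousMap.const _ (fun i => w (Sum.inl i), fun i => w (Sum.inr i)))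
  map_smul' c v := (pencilSol E.volterra₀ E.volterra₁ lam).map_smul c
    (ContinuousMap.const _ (fun i => v (Sum.inl i), fun i => v (Sum.inr i)))

theorem solLin_elim (E : SLEquation d a b) (lam : ℂ) (c : (Fin d → ℂ) × (Fin d → ℂ)) :
    E.solLin lam (Sum.elim c.1 c.2) = E.sol lam c := rfl

theorem mem_graph_solLin (E : SLEquation d a b) (C : SLBoundary d) {lam : ℂ}
    {v : Fin d ⊕ Fin d → ℂ} (hv : C.form E.lt.le (E.solLin lam v) = 0) :
    (E.toL2W (E.solLin lam v), lam • E.toL2W (E.solLin lam v)) ∈ E.graph C := by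
  have := E.mem_graph_of_eq C (G := 0) (by
    rw [map_zero, add_zero]
    exact E.sol_eq lam (fun i => v (Sum.inl i), fun i => v (Sum.inr i))) hv
  rwa [map_zero, add_zero] at this

theorem exists_solLin_of_mem_graph (E : SLEquation d a b) (C : SLBoundary d) {lam : ℂ}
    {u : E.L2W} (hu : (u, lam • u) ∈ E.graph C) :
    ∃ v, C.form E.lt.le (E.solLin lam v) = 0 ∧ E.toL2W (E.solLin lam v) = u := by
  obtain ⟨y, z, h, hb, h1, h2⟩ := hu
  have hs : E.IsSolution lam y z := by
    refine ⟨h, ?_⟩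
    filter_upwards [h1, h2, E.ae_isUnit_W, AEEqFun.coeFn_smul lam u.1] with t e1 e2 hW e3
    change (lam • u.1 : ℝ →ₘ[lebIcc a b] (Fin d → ℂ)) t = _ at e2
    rw [e3, Pi.smul_apply] at e2
    rw [← e1, ← Matrix.mulVec_smul, e2, inv_cplx hW, Matrix.mulVec_mulVec, cplx_mul_inv hW,
      Matrix.one_mulVec]
  have hx : ∀ t (ht : t ∈ Set.Icc a b), E.solLin lam (Sum.elim (y a) (z a)) ⟨t, ht⟩ = (y t, z t) :=
    fun t ht => (hs.eq_sol ht).symm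
  refine ⟨Sum.elim (y a) (z a), ?_, Subtype.ext (AEEqFun.ext ?_)⟩
  · rw [E.form_eq_zero_iff C]
    simpa only [SLBoundary.Holds, extend_left, extend_right, hx] using hb
  · filter_upwards [h1, E.coeFn_toL2W (E.solLin lam (Sum.elim (y a) (z a))),
      ae_mem_Ioo a b] with t e1 e2 hm
    rw [e1, e2, E.extend_of_mem _ (Set.Ioo_subset_Icc_self hm), hx]

/-- The class retains only `y`, but it determines `z`: if `y = 0` almost everywhere, then everywhere
by continuity, so `z = P y'` vanishes as well, and with it the initial vector. -/
theorem toL2W_solLin_injective (E : SLEquation d a b) (lam : ℂ) :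
    Function.Injective (E.toL2W ∘ₗ E.solLin lam) := by
  refine (injective_iff_map_eq_zero _).2 fun v hv => ?_
  have h := (E.isSolution_extend_sol lam (fun i => v (Sum.inl i), fun i => v (Sum.inr i))).1
  have h0 : (fun t => (E.extend (E.solLin lam v) t).1) =ᵐ[volume.restrict (Set.Icc a b)]
      fun _ => 0 := by
    refine (E.coeFn_toL2W _).symm.trans ?_
    rw [show E.toL2W (E.solLin lam v) = 0 from hv]
    exact AEEqFun.coeFn_zero
  have hIcc : Set.uIcc a b = Set.Icc a b := Set.uIcc_of_le E.lt.le
  have hy0 := Measure.eqOn_Icc_of_ae_eq volume E.lt.ne h0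
    (h.ac.continuousOn.mono hIcc.ge)
    continuousOn_const
  have hz : (fun t => (E.extend (E.solLin lam v) t).2) =ᵐ[volume.restrict (Set.Icc a b)]
      fun _ => 0 := by
    filter_upwards [h.eq, ae_mem_Ioo a b] with t ht hm
    refine ht.trans ?_
    rw [← Matrix.mulVec_zero (cplx (E.P t))]
    exact congrArg _ (deriv_eq_zero_of_eqOn hy0 hm)
  have hz0 := Measure.eqOn_Icc_of_ae_eq volume E.lt.ne hz
    (h.ac_quasi.continuousOn.mono hIcc.ge)
    continuousOn_const
  have ha : E.extend (E.solLin lam v) a = (fun i => v (Sum.inl i), fun i => v (Sum.inr i)) := by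
    rw [extend_left]
    exact E.sol_left lam _
  have k1 := hy0 (Set.left_mem_Icc.2 E.lt.le)
  have k2 := hz0 (Set.left_mem_Icc.2 E.lt.le)
  simp only [ha] at k1 k2
  ext i
  cases i with
  | inl i => exact congrFun k1 i
  | inr i => exact congrFun k2 i

theorem eigenspace_eq_map (E : SLEquation d a b) (C : SLBoundary d) (lam : ℂ) :
    (E.operator C).eigenspace lam =
      (LinearMap.ker ((C.form E.lt.le).toLinearMap ∘ₗ E.solLin lam)).map
        (E.toL2W ∘ₗ E.solLin lam) := by
  ext u
  rw [LinearPMap.mem_eigenspace_iff, operator_graph, Submodule.mem_map]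
  exact ⟨fun hu => E.exists_solLin_of_mem_graph C hu,
    fun ⟨v, hv, e⟩ => e ▸ E.mem_graph_solLin C hv⟩

theorem isFundamental_fundamental (E : SLEquation d a b) (lam : ℂ) (j : Fin d ⊕ Fin d) :
    E.IsFundamental lam j (E.fundamental lam j) := by
  let c : (Fin d → ℂ) × (Fin d → ℂ) :=
    (fun i => (Pi.single j 1 : Fin d ⊕ Fin d → ℂ) (Sum.inl i),
      fun i => (Pi.single j 1 : Fin d ⊕ Fin d → ℂ) (Sum.inr i))
  refine Classical.epsilon_spec (p := E.IsFundamental lam j)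
    ⟨(fun t => (E.extend (E.sol lam c) t).1, fun t => (E.extend (E.sol lam c) t).2),
      E.isSolution_extend_sol lam c, fun i => ?_⟩
  simp only [extend_left, sol_left, c]
  cases i <;> simp [Matrix.one_apply, Pi.single_apply]

/-- By uniqueness, the choice made by `Classical.epsilon` does not affect the values on `[a, b]`. -/
theorem fundamental_eq (E : SLEquation d a b) (lam : ℂ) (j : Fin d ⊕ Fin d) {t : ℝ}
    (ht : t ∈ Set.Icc a b) :
    ((E.fundamental lam j).1 t, (E.fundamental lam j).2 t) =
      E.solLin lam (Pi.single j 1) ⟨t, ht⟩ := by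
  obtain ⟨h1, h2⟩ := E.isFundamental_fundamental lam j
  rw [h1.eq_sol ht, ← solLin_elim]
  congr 2
  ext i
  rw [h2, Matrix.one_apply, Pi.single_apply]

theorem boundaryMatrix_eq (E : SLEquation d a b) (C : SLBoundary d) (lam : ℂ) :
    C.A * E.Phi lam + C.B * E.Psi lam =
      LinearMap.toMatrix' ((C.form E.lt.le).toLinearMap ∘ₗ E.solLin lam) := by
  ext i j
  have ha := E.fundamental_eq lam j (Set.left_mem_Icc.2 E.lt.le)
  have hb := E.fundamental_eq lam j (Set.right_mem_Icc.2 E.lt.le)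
  change (C.A *ᵥ Sum.elim (-(E.fundamental lam j).1 a) ((E.fundamental lam j).1 b)) i +
    (C.B *ᵥ Sum.elim ((E.fundamental lam j).2 a) ((E.fundamental lam j).2 b)) i =
    LinearMap.toMatrix' ((C.form E.lt.le).toLinearMap ∘ₗ E.solLin lam) i j
  rw [LinearMap.toMatrix'_apply]
  change _ = (C.A *ᵥ Sum.elim (-(E.solLin lam (Pi.single j 1) _).1)
    (E.solLin lam (Pi.single j 1) _).1) i + (C.B *ᵥ Sum.elim
    (E.solLin lam (Pi.single j 1) _).2 (E.solLin lam (Pi.single j 1) _).2) i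
  rw [← ha, ← hb]

theorem analyticAt_solLin (E : SLEquation d a b) (lam : ℂ) (v : Fin d ⊕ Fin d → ℂ) :
    AnalyticAt ℂ (fun l => E.solLin l v) lam :=
  E.analyticAt_sol lam _

theorem Gam_order_eq_finrank (E : SLEquation d a b) (C : SLBoundary d) {lam : ℂ}
    (hlam : star lam = lam) :
    analyticOrderAt (E.Gam C) lam = Module.finrank ℂ
      (LinearMap.ker ((C.form E.lt.le).toLinearMap ∘ₗ E.solLin lam)) := by
  have hM : ∀ l v, LinearMap.toMatrix' ((C.form E.lt.le).toLinearMap ∘ₗ E.solLin l) *ᵥ v =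
      C.form E.lt.le (E.solLin l v) := fun l v => LinearMap.toMatrix'_mulVec _ _
  have hG : E.Gam C = fun l =>
      (LinearMap.toMatrix' ((C.form E.lt.le).toLinearMap ∘ₗ E.solLin l)).det := by
    ext1 l
    rw [Gam, boundaryMatrix_eq]
  rw [hG, analyticOrderAt_det_eq_finrank_ker, ← Matrix.toLin'_apply', Matrix.toLin'_toMatrix']
  · intro i j
    simp only [LinearMap.toMatrix'_apply]
    exact ((ContinuousLinearMap.proj (R := ℂ) (φ := fun _ : Fin d ⊕ Fin d => ℂ) i ∘L
      C.form E.lt.le).analyticAt _).comp (E.analyticAt_solLin lam (Pi.single j 1))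
  · intro v w hv hw
    simp only [hM] at hv hw
    have hd := (C.form E.lt.le).hasFDerivAt.comp_hasDerivAt lam
      (E.analyticAt_solLin lam v).differentiableAt.hasDerivAt
    set x' := deriv (fun l => E.solLin l v) lam with hx'
    have hw' : C.form E.lt.le x' = C.form E.lt.le (E.solLin lam w) := by
      rw [← hw]
      exact hd.deriv.symm
    have e1 : x' = E.volterra₀ x' + lam • E.volterra₁ x' + E.volterra₁ (E.solLin lam v) :=
      deriv_pencilSol_eq E.isUnit_one_sub _
    have e2 : E.solLin lam w = _ :=
      E.sol_eq lam (fun i => w (Sum.inl i), fun i => w (Sum.inr i))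
    -- The function `x'` has initial value zero, hence the constant `-w`. By `hw'` the difference
    -- satisfies the boundary condition, and `T - λ` maps it to the eigenfunction with initial
    -- vector `v`.
    have hgr := E.mem_graph_of_eq C (lam := lam) (x := x' - E.solLin lam w)
      (c := -(fun i => w (Sum.inl i), fun i => w (Sum.inr i))) (G := E.solLin lam v) (by
        rw [map_sub, map_sub]
        change _ = -ContinuousMap.const _ (fun i => w (Sum.inl i), fun i => w (Sum.inr i)) + _
        change E.solLin lam w = ContinuousMap.const _ (fun i => w (Sum.inl i), fun i => w (Sum.inr i))
          + (E.volterra₀ (E.solLin lam w) + lam • E.volterra₁ (E.solLin lam w)) at e2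
        nth_rewrite 1 [e1]
        nth_rewrite 1 [e2]
        rw [smul_sub]
        abel) (by rw [map_sub, hw', sub_self])
    have h0 := eq_zero_of_mem_graph hlam hgr (E.mem_graph_solLin C hv)
    exact E.toL2W_solLin_injective lam (h0.trans (map_zero _).symm)

end SLEquation

theorem theorem5p1 {d : ℕ} {a b : ℝ} (E : SLEquation d a b) (C : SLBoundary d) (lam : ℂ)
    (hlam : E.IsEigenvalue C lam) :
    E.analyticMultiplicity C lam = E.geometricMultiplicity C lam ∧
      E.geometricMultiplicity C lam = E.algebraicMultiplicity C lam ∧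
      E.geometricMultiplicity C lam ≠ ⊤ := by
  obtain ⟨u, hu0, hu⟩ := hlam
  have hreal : star lam = lam := by
    refine SLEquation.conj_eq_of_mem_graph (C := C) (u := (u : E.L2W)) ?_ hu0
    rw [← E.operator_graph C, LinearPMap.mem_graph_iff]
    exact ⟨u, rfl, hu⟩
  have hgeo : E.geometricMultiplicity C lam = Module.finrank ℂ
      (LinearMap.ker ((C.form E.lt.le).toLinearMap ∘ₗ E.solLin lam)) := by
    rw [SLEquation.geometricMultiplicity, E.eigenspace_eq_map C lam,
      ← (Submodule.equivMapOfInjective _ (E.toL2W_solLin_injective lam) _).rank_eq,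
      ← Module.finrank_eq_rank]
    simp
  have hroot : (E.operator C).rootSpace lam = (E.operator C).eigenspace lam := by
    refine LinearPMap.rootSpace_eq_eigenspace _ fun u f h1 h2 => ?_
    rw [E.operator_graph C] at h1 h2
    exact SLEquation.eq_zero_of_mem_graph hreal h1 h2
  refine ⟨(E.Gam_order_eq_finrank C hreal).trans hgeo.symm, ?_, ?_⟩
  · rw [SLEquation.algebraicMultiplicity, hroot, SLEquation.geometricMultiplicity]
  · rw [hgeo]
    exact ENat.natCast_ne_top _
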